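/- **Setting.** Let $\mathcal G$ be a strongly connected digraph on the nodes $1,\dots,n$, in which every node is also a neighbour of itself. Let $\underline B=(b_{ij})\in\mathbb R^{n\times n}$ be column stochastic, with $b_{ij}>0$ if node $i$ receives information from node $j$ and $b_{ij}=0$ otherwise. Let $\boldsymbol\pi>0$ be its Perron vector, $\underline B\boldsymbol\pi=\boldsymbol\pi$, $\mathbf 1_n^\top\boldsymbol\pi=1$, and put $\underline B^\infty:=\boldsymbol\pi\mathbf 1_n^\top$. Let $f_1,\dots,f_n:\mathbb R^p\to\mathbb R$ be differentiable with, for some $\mu,\ell>0$ and all $\mathbf x,\mathbf y,i$, $$\tfrac\mu2\|\mathbf x-\mathbf y\|_2^2\le f_i(\mathbf y)-f_i(\mathbf x)-\nabla f_i(\mathbf x)^\top(\mathbf y-\mathbf x)\le\tfrac\ell2\|\mathbf x-\mathbf y\|_2^2 ,$$ and let $\mathbf z^*$ be the minimizer of $F:=\frac1n\sum_i f_i$. **Algorithm (S-ADDOPT).** Given deterministic $\mathbf x_0^i\in\mathbb R^p$, put $\mathbf z_0^i=\mathbf x_0^i$, $y_0^i=1$, $\mathbf w_0^i=\mathbf g_0^i$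 and, for $k\ge0$, $$\mathbf x_{k+1}^i=\sum_j b_{ij}\mathbf x_k^j-\alpha_k\mathbf w_k^i,\quad y_{k+1}^i=\sum_j b_{ij}y_k^j,\quad \mathbf z_{k+1}^i=\mathbf x_{k+1}^i/y_{k+1}^i,\quad \mathbf w_{k+1}^i=\sum_j b_{ij}\mathbf w_k^j+\mathbf g_{k+1}^i-\mathbf g_k^i .$$ Here $\mathbf g_k^i$ is a stochastic gradient of $f_i$ at $\mathbf z_k^i$: for a filtration $(\mathcal F_k)$ such that $\mathbf g_k^i$ is $\mathcal F_{k+1}$-measurable (for instance, $\mathcal F_k$ generated by all the samples drawn before iteration $k$), $\mathbf g_k^i$ is integrable, $\mathbf g_k^i-\nabla f_i(\mathbf z_k^i)$ is square integrable, $$\mathbb E[\mathbf g_k^i\mid\mathcal F_k]=\nabla f_i(\mathbf z_k^i),\qquad \mathbb E[\|\mathbf g_k^i-\nabla f_i(\mathbf z_k^i)\|_2^2\mid\mathcal F_k]\le\sigma^2 ,$$ and the noises $\mathbf g_k^i-\nabla f_i(\mathbf z_k^i)$ of different nodes in the same iteration are conditionally uncorrelated given $\mathcal F_k$ (their inner products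 have conditional mean $0$), as is the case if the nodes sample independently. **Notation.** $\overline\pi$, $\underline\pi$ are the largest and the smallest entry of $\boldsymbol\pi$; $h:=\overline\pi/\underline\pi$; $\|\mathbf x\|_{\boldsymbol\pi}^2:=\sum_i\|\mathbf x^i\|_2^2/\pi_i$; $\sigma_B:=\|\mathrm{diag}(\sqrt{\boldsymbol\pi})^{-1}(\underline B-\underline B^\infty)\,\mathrm{diag}(\sqrt{\boldsymbol\pi})\|_2$; $Y_k:=\mathrm{diag}(\mathbf y_k)$; $y:=\sup_k\|Y_k\|_2$; $y_-:=\sup_k\|Y_k^{-1}\|_2$; $\beta:=\sqrt h\,\|\mathbf 1_n-n\boldsymbol\pi\|_2$; $q:=\frac{1+\sigma_B^2}{1-\sigma_B^2}$; $k_1:=\frac{1-\sigma_B^2}3$; $k_2:=6\ell^2qy_-^2h$; $E_1:=(1+\beta\sigma_B)y_-^2\overline\pi$; $E_3:=18qy_-^4y^2\underline\pi^{-1}$; $$E_2:=4k_2+\frac{2\ell^2y^2k_2\theta^2}{m^2}\cdot\frac{2k_1m^2-3k_2\theta^2}{k_1m^2-2k_2\theta^2}\,(1+\beta\sigma_B).$$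 Further, $\overline{\mathbf x}_k:=\frac1n\sum_i\mathbf x_k^i$; $\widehat{\mathbf x}_k$ has the blocks $\widehat{\mathbf x}_k^i:=\pi_i\sum_j\mathbf x_k^j$; and $\mathbf e_k:=\frac1n\sum_i\mathbb E\|\mathbf z_k^i-\mathbf z^*\|_2^2$. **Theorem.** Let $\alpha_k:=\frac\theta{m+k}$ with $\theta>\frac1\mu$ and with $m$ such that $$m>\max\Big\{\frac{\theta(\ell+\mu)}2,\ \frac{6\ell\theta y_-\sqrt{(1+\sigma_B^2)h}}{1-\sigma_B^2}\Big\},$$ $$\frac{(1-\sigma_B^2)^2}{6\theta^2(1+\sigma_B^2)}\Big(\frac{1-\sigma_B^2}2-\frac{2m+1}{(m+1)^2}\Big)>\frac{E_2}{m^2}+\Big(\frac{\theta^3\ell^6E_1E_3}{m^4n(\theta\mu-1)}\Big)\Big(\frac{\theta\mu+m}{m\mu}\Big).$$ Then $\sigma_B^k\le\frac1{n(m+k)^2}$ for all large $k$, the expectations below are finite, and for all $k\ge0$, with $\mathcal O(1)$ standing for constants that do not depend on $k$, $$\mathbb E\|\mathbf x_k-\widehat{\mathbf x}_k\|_{\boldsymbol\pi}^2\le\frac{\mathcal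 O(1)}{(m+k)^2},$$ $$\mathbb E\|\overline{\mathbf x}_k-\mathbf z^*\|_2^2\le\frac{2\theta^2\sigma^2}{n(\theta\mu-1)(m+k)}+\frac{\mathcal O(1)}{(m+k)^{\theta\mu}}+\frac{\mathcal O(1)}{(m+k)^2}.$$ Hence $\mathbf e_k\to0$ at the rate $\mathcal O(1/k)$, and this rate is asymptotically network-independent: $$\mathbf e_k\le\frac{4\theta^2\sigma^2}{n(\theta\mu-1)(m+k)}+\frac{\mathcal O(1)}{(m+k)^{\theta\mu}}+\frac{\mathcal O(1)}{(m+k)^2}.$$ -/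

import Mathlib

open MeasureTheory ProbabilityTheory Filter Topology

namespace SADDOPT

noncomputable section

/-! ### Network quantities -/

/-- The digraph is strongly connected and every node is a neighbour of itself.
`G.Adj i j` means that node `i` receives information from node `j`. -/
structure IsStronglyConnectedNetwork {n : ℕ} (G : Digraph (Fin n)) : Prop where
  self_adj : ∀ i, G.Adj i i
  connected : ∀ i j, Relation.ReflTransGen G.Adj i j

/-- `B` is a column stochastic weight matrix of the digraph `G`: `B i j > 0` exactly when
node `i` receives information from node `j`. -/
structure IsWeightMatrix {n : ℕ} (G : Digraph (Fin n)) (B : Matrix (Fin n) (Fin n) ℝ) :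
    Prop where
  pos : ∀ i j, G.Adj i j → 0 < B i j
  zero : ∀ i j, ¬ G.Adj i j → B i j = 0
  col_sum : ∀ j, ∑ i, B i j = 1

/-- `v` is the right Perron eigenvector of the column stochastic matrix `B`, normalized
by `1ᵀ v = 1` (so that `B^∞ = v 1ᵀ`). -/
structure IsPerronVector {n : ℕ} (B : Matrix (Fin n) (Fin n) ℝ) (v : Fin n → ℝ) : Prop where
  pos : ∀ i, 0 < v i
  sum_eq_one : ∑ i, v i = 1
  eigen : B.mulVec v = v

/-- The spectral norm of a real square matrix (operator norm for the Euclidean norm). -/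
def specNorm {n : ℕ} (X : Matrix (Fin n) (Fin n) ℝ) : ℝ :=
  ‖Matrix.toEuclideanCLM (n := Fin n) (𝕜 := ℝ) X‖

/-- The matrix norm `‖diag(√π)⁻¹ X diag(√π)‖₂`. -/
def piMatrixNorm {n : ℕ} (v : Fin n → ℝ) (X : Matrix (Fin n) (Fin n) ℝ) : ℝ :=
  specNorm (Matrix.diagonal (fun i => (√(v i))⁻¹) * X * Matrix.diagonal (fun i => √(v i)))

/-- The limit matrix `B^∞ = π 1ᵀ`. -/
def limitMatrix {n : ℕ} (v : Fin n → ℝ) : Matrix (Fin n) (Fin n) ℝ :=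
  Matrix.of fun i _ => v i

/-- `σ_B = ‖B - B^∞‖_π`. -/
def sigmaB {n : ℕ} (B : Matrix (Fin n) (Fin n) ℝ) (v : Fin n → ℝ) : ℝ :=
  piMatrixNorm v (B - limitMatrix v)

/-- The largest entry of `π`. -/
def piMax {n : ℕ} (v : Fin n → ℝ) : ℝ := ⨆ i, v i

/-- The smallest entry of `π`. -/
def piMin {n : ℕ} (v : Fin n → ℝ) : ℝ := ⨅ i, v i

/-- `h = max π / min π`. -/
def hRatio {n : ℕ} (v : Fin n → ℝ) : ℝ := piMax v / piMin v

/-- `β = √h ‖1 - n π‖₂`. -/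
def betaConst {n : ℕ} (v : Fin n → ℝ) : ℝ :=
  √(hRatio v) * ‖WithLp.toLp 2 (fun i => 1 - (n : ℝ) * v i)‖

/-- The eigenvector estimates `y_0 = 1`, `y_{k+1} = B y_k`. -/
def yIter {n : ℕ} (B : Matrix (Fin n) (Fin n) ℝ) : ℕ → Fin n → ℝ
  | 0 => fun _ => 1
  | k + 1 => B.mulVec (yIter B k)

/-- `y = sup_k ‖Y_k‖₂`, where `Y_k = diag(y_k)`. -/
def ySup {n : ℕ} (B : Matrix (Fin n) (Fin n) ℝ) : ℝ :=
  ⨆ k : ℕ, specNorm (Matrix.diagonal (yIter B k))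

/-- `y_- = sup_k ‖Y_k⁻¹‖₂`. -/
def yInvSup {n : ℕ} (B : Matrix (Fin n) (Fin n) ℝ) : ℝ :=
  ⨆ k : ℕ, specNorm (Matrix.diagonal (yIter B k))⁻¹

/-! ### The constants in the conditions on the step-size -/

/-- `q = (1 + σ_B²) / (1 - σ_B²)`. -/
def qConst {n : ℕ} (B : Matrix (Fin n) (Fin n) ℝ) (v : Fin n → ℝ) : ℝ :=
  (1 + sigmaB B v ^ 2) / (1 - sigmaB B v ^ 2)

/-- `k₁ = (1 - σ_B²) / 3`. -/
def k1Const {n : ℕ} (B : Matrix (Fin n) (Fin n) ℝ) (v : Fin n → ℝ) : ℝ :=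
  (1 - sigmaB B v ^ 2) / 3

/-- `k₂ = 6 ℓ² q y_-² h`. -/
def k2Const {n : ℕ} (B : Matrix (Fin n) (Fin n) ℝ) (v : Fin n → ℝ) (l : ℝ) : ℝ :=
  6 * l ^ 2 * qConst B v * yInvSup B ^ 2 * hRatio v

/-- `E₁ = (1 + β σ_B) y_-² max π`. -/
def E1Const {n : ℕ} (B : Matrix (Fin n) (Fin n) ℝ) (v : Fin n → ℝ) : ℝ :=
  (1 + betaConst v * sigmaB B v) * yInvSup B ^ 2 * piMax v

/-- `E₂ = 4 k₂ + (2 ℓ² y² k₂ θ² / m²) ((2 k₁ m² - 3 k₂ θ²) / (k₁ m² - 2 k₂ θ²)) (1 + β σ_B)`. -/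
def E2Const {n : ℕ} (B : Matrix (Fin n) (Fin n) ℝ) (v : Fin n → ℝ) (l θ m : ℝ) : ℝ :=
  4 * k2Const B v l +
    (2 * l ^ 2 * ySup B ^ 2 * k2Const B v l * θ ^ 2 / m ^ 2) *
      ((2 * k1Const B v * m ^ 2 - 3 * k2Const B v l * θ ^ 2) /
        (k1Const B v * m ^ 2 - 2 * k2Const B v l * θ ^ 2)) *
      (1 + betaConst v * sigmaB B v)

/-- `E₃ = 18 q y_-⁴ y² / min π`. -/
def E3Const {n : ℕ} (B : Matrix (Fin n) (Fin n) ℝ) (v : Fin n → ℝ) : ℝ :=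
  18 * qConst B v * yInvSup B ^ 4 * ySup B ^ 2 * (piMin v)⁻¹

/-! ### The objective -/

/-- `f` is differentiable, `μ`-strongly convex and `l`-smooth. -/
structure IsStronglyConvexSmooth {p : ℕ} (μ l : ℝ) (f : EuclideanSpace ℝ (Fin p) → ℝ) :
    Prop where
  differentiable : Differentiable ℝ f
  lower : ∀ x y, μ / 2 * ‖x - y‖ ^ 2 ≤ f y - f x - inner ℝ (gradient f x) (y - x)
  upper : ∀ x y, f y - f x - inner ℝ (gradient f x) (y - x) ≤ l / 2 * ‖x - y‖ ^ 2

/-- The global cost `F = (1/n) ∑ f_i`. -/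
def globalCost {n p : ℕ} (f : Fin n → EuclideanSpace ℝ (Fin p) → ℝ) :
    EuclideanSpace ℝ (Fin p) → ℝ :=
  fun z => (1 / (n : ℝ)) * ∑ i, f i z

/-! ### The algorithm, along one sequence of sampled gradients

`g k i` is the stochastic gradient returned to node `i` at its query point `z_k^i`. The sample
`g k i` used in step `k` is used again in step `k + 1`. -/

/-- `w_0^i = g_0^i`, `w_{k+1}^i = ∑_j b_ij w_k^j + g_{k+1}^i - g_k^i`. -/
def wIter {n p : ℕ} (B : Matrix (Fin n) (Fin n) ℝ)
    (g : ℕ → Fin n → EuclideanSpace ℝ (Fin p)) : ℕ → Fin n → EuclideanSpace ℝ (Fin p)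
  | 0 => g 0
  | k + 1 => fun i => ∑ j, B i j • wIter B g k j + g (k + 1) i - g k i

/-- `x_{k+1}^i = ∑_j b_ij x_k^j - α_k w_k^i`. -/
def xIter {n p : ℕ} (B : Matrix (Fin n) (Fin n) ℝ) (α : ℕ → ℝ)
    (x₀ : Fin n → EuclideanSpace ℝ (Fin p))
    (g : ℕ → Fin n → EuclideanSpace ℝ (Fin p)) : ℕ → Fin n → EuclideanSpace ℝ (Fin p)
  | 0 => x₀
  | k + 1 => fun i => ∑ j, B i j • xIter B α x₀ g k j - α k • wIter B g k i

/-- `z_k^i = x_k^i / y_k^i`. -/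
def zIter {n p : ℕ} (B : Matrix (Fin n) (Fin n) ℝ) (α : ℕ → ℝ)
    (x₀ : Fin n → EuclideanSpace ℝ (Fin p))
    (g : ℕ → Fin n → EuclideanSpace ℝ (Fin p)) (k : ℕ) (i : Fin n) :
    EuclideanSpace ℝ (Fin p) :=
  (yIter B k i)⁻¹ • xIter B α x₀ g k i

/-- The decaying step-sizes `α_k = θ / (m + k)`. -/
def decayingStep (θ m : ℝ) (k : ℕ) : ℝ := θ / (m + k)

/-! ### Errors, along one sequence of sampled gradients -/

/-- The average `x̄ = (1/n) ∑ x^i`. -/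
def mean {n p : ℕ} (x : Fin n → EuclideanSpace ℝ (Fin p)) : EuclideanSpace ℝ (Fin p) :=
  (1 / (n : ℝ)) • ∑ i, x i

/-- The weighted average `x̂ = B^∞ x`, block by block. -/
def weightedAvg {n p : ℕ} (v : Fin n → ℝ) (x : Fin n → EuclideanSpace ℝ (Fin p)) :
    Fin n → EuclideanSpace ℝ (Fin p) :=
  fun i => ∑ j, limitMatrix v i j • x j

/-- The squared weighted norm `‖x‖_π² = ∑_i ‖x^i‖² / π_i`. -/
def piNormSq {n p : ℕ} (v : Fin n → ℝ) (x : Fin n → EuclideanSpace ℝ (Fin p)) : ℝ :=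
  ∑ i, ‖x i‖ ^ 2 / v i

/-- The squared agreement error `‖x - x̂‖_π²`. -/
def agreementError {n p : ℕ} (v : Fin n → ℝ) (x : Fin n → EuclideanSpace ℝ (Fin p)) : ℝ :=
  piNormSq v (fun i => x i - weightedAvg v x i)

/-- The squared optimality gap `‖x̄ - z*‖²`. -/
def optimalityGap {n p : ℕ} (zstar : EuclideanSpace ℝ (Fin p))
    (x : Fin n → EuclideanSpace ℝ (Fin p)) : ℝ :=
  ‖mean x - zstar‖ ^ 2

/-- The mean squared error over the network, `(1/n) ∑_i ‖z^i - z*‖²`. -/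
def networkError {n p : ℕ} (zstar : EuclideanSpace ℝ (Fin p))
    (z : Fin n → EuclideanSpace ℝ (Fin p)) : ℝ :=
  (1 / (n : ℝ)) * ∑ i, ‖z i - zstar‖ ^ 2

/-! ### The stochastic first-order oracle -/

/-- `g k i` is a stochastic gradient of `f i` at the random query point `z k i`. The σ-algebra
`ℱ k` holds the samples drawn before iteration `k`, the noise has conditional mean zero and
conditional variance at most `σ²`, and the noises of different nodes in the same iteration are
conditionally uncorrelated (in particular, nodes may sample independently). -/
structure IsStochasticOracle {Ω : Type*} [mΩ : MeasurableSpace Ω] (P : Measure Ω)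
    {n p : ℕ} (ℱ : Filtration ℕ mΩ) (f : Fin n → EuclideanSpace ℝ (Fin p) → ℝ) (σ : ℝ)
    (z g : ℕ → Fin n → Ω → EuclideanSpace ℝ (Fin p)) : Prop where
  measurable : ∀ k i, StronglyMeasurable[ℱ (k + 1)] (g k i)
  integrable : ∀ k i, Integrable (g k i) P
  integrable_sq : ∀ k i,
    Integrable (fun ω => ‖g k i ω - gradient (f i) (z k i ω)‖ ^ 2) P
  unbiased : ∀ k i, P[g k i | ℱ k] =ᵐ[P] fun ω => gradient (f i) (z k i ω)
  variance_le : ∀ k i,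
    P[fun ω => ‖g k i ω - gradient (f i) (z k i ω)‖ ^ 2 | ℱ k] ≤ᵐ[P] fun _ => σ ^ 2
  uncorrelated : ∀ k i j, i ≠ j →
    P[fun ω => inner ℝ (g k i ω - gradient (f i) (z k i ω))
      (g k j ω - gradient (f j) (z k j ω)) | ℱ k] =ᵐ[P] fun _ => (0 : ℝ)

end

end SADDOPT

open SADDOPT

/-!
The step-size `θ / (m + k)` tends to zero, so all rates follow from recursions between three
expected squares: the optimality gap `D` of the average `x̄_k`, the agreement error `X`, and the size
`U` of the tracking deviation `w_k - g_k`.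

* `B` contracts in the `π`-weighted norm on vectors of sum zero (`sigmaB_lt_one`): the loss of norm
  is a Dirichlet form, which by strong connectivity vanishes only on multiples of `π`. Hence `X` and
  `U` contract geometrically (`exists_contraction`), with the sampled gradients as forcing term, and
  the eigenvector estimates `y_k` converge geometrically to `n π`.
* The average `x̄_k` performs a gradient step with averaged gradients at the points `z_k^i`. Since
  the noise is conditionally centred and uncorrelated between nodes, it adds `α_k² σ² / n`
  (`IsStochasticOracle.exists_integral_optimalityGap_succ_le`). The contraction factor of the
  squared distance is `1 - lam α_k` with `lam` as close to `2 μ` as desired, and `θ μ > 1` permits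
  `lam θ > 2`.

A Lyapunov function bounds `D` and `X` (`bounded_of_coupled_recursion`). Then the forcing term of
`U` is bounded, the forcing term of `X` is of order `α_k²`, so that `X = O(1 / (m + k)²)`, and `X`
enters the recursion for `D` only at order `1 / (m + k)³`. Chung's lemma
(`le_of_recursion_one_sub_div`) turns this into
`D ≤ θ² (σ² / n) / (lam θ - 1) / (m + k) + O(1 / (m + k)²)`; because `lam θ > 2`, neither the
initial condition nor the agreement error leaves a term that decays more slowly than
`1 / (m + k)²`. The network error is at most twice the optimality gap plus
`O(1 / (m + k)²)` (`IsStochasticOracle.networkError_rate`).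
-/

namespace SADDOPT

/-! ### Real recursions with step-size `θ / (m + k)` -/

theorem exists_forall_le_of_eventually_le {f b w : ℕ → ℝ} (hw : ∀ k, 0 < w k) {K : ℕ} {C : ℝ}
    (h : ∀ k, K ≤ k → f k ≤ b k + C * w k) : ∃ C', ∀ k, f k ≤ b k + C' * w k := by
  refine ⟨max C (∑ j ∈ Finset.range K, |f j - b j| / w j), fun k => ?_⟩
  rcases le_or_gt K k with hk | hk
  · refine (h k hk).trans ?_
    gcongr
    · exact (hw k).le
    · exact le_max_left _ _
  · have h1 : |f k - b k| / w k ≤ ∑ j ∈ Finset.range K, |f j - b j| / w j :=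
      Finset.single_le_sum (f := fun j => |f j - b j| / w j)
        (fun j _ => div_nonneg (abs_nonneg _) (hw j).le) (Finset.mem_range.2 hk)
    have h2 := h1.trans (le_max_right C _)
    rw [div_le_iff₀ (hw k)] at h2
    linarith [le_abs_self (f k - b k)]

theorem tendsto_const_div_add_natCast (m θ : ℝ) :
    Tendsto (fun k : ℕ => θ / (m + k)) atTop (𝓝 0) :=
  tendsto_const_nhds.div_atTop
    (tendsto_atTop_add_const_left _ m tendsto_natCast_atTop_atTop)

theorem eventually_le_add_natCast (m a : ℝ) : ∃ K : ℕ, ∀ k : ℕ, K ≤ k → a ≤ m + k := by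
  obtain ⟨K, hK⟩ := exists_nat_ge (a - m)
  refine ⟨K, fun k hk => ?_⟩
  have : (K : ℝ) ≤ k := by exact_mod_cast hk
  linarith

/-- Chung's lemma for a contraction factor `1 - a / (m + k)` with `a > 2`: the forcing term
`A / (m + k)²` produces the leading term with its exact constant `A / (a - 1)`. -/
theorem le_of_recursion_one_sub_div {m a A A' : ℝ} (hm : 0 < m) (ha : 2 < a) (hA : 0 ≤ A)
    {D : ℕ → ℝ}
    (hD : ∀ k : ℕ, D (k + 1) ≤ (1 - a / (m + k)) * D k + A / (m + k) ^ 2 + A' / (m + k) ^ 3) :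
    ∃ C, ∀ k : ℕ, D k ≤ A / (a - 1) / (m + k) + C / (m + k) ^ 2 := by
  have ht : ∀ k : ℕ, 0 < m + k := fun k => by positivity
  obtain ⟨K, hK⟩ := eventually_le_add_natCast m a
  set C := max (max 0 (A' / (a - 2))) (D K * (m + K) ^ 2)
  have hC0 : 0 ≤ C := (le_max_left _ _).trans (le_max_left _ _)
  have hC1 : A' ≤ C * (a - 2) := by
    rw [← div_le_iff₀ (by linarith)]
    exact (le_max_right _ _).trans (le_max_left _ _)
  have hC2 : D K * (m + K) ^ 2 ≤ C := le_max_right _ _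
  set A₁ := A / (a - 1)
  have hA1 : A₁ * (a - 1) = A := div_mul_cancel₀ _ (by linarith)
  have hA10 : 0 ≤ A₁ := div_nonneg hA (by linarith)
  have key : ∀ k, K ≤ k → D k ≤ A₁ / (m + k) + C * (1 / (m + k) ^ 2) := by
    intro k hk
    induction k, hk using Nat.le_induction with
    | base =>
      have h1 : D K ≤ C * (1 / (m + K) ^ 2) := by
        rw [mul_one_div, le_div_iff₀ (pow_pos (ht K) 2)]
        exact hC2
      have := div_nonneg hA10 (ht K).le
      linarith
    | succ k hk ih =>
      have htk := ht k
      have hak := hK k hk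
      refine (hD k).trans ?_
      push_cast
      set t := m + (k : ℝ) with htdef
      rw [show m + ((k : ℝ) + 1) = t + 1 by rw [htdef]; ring]
      have h0 : 0 ≤ 1 - a / t := by
        rw [sub_nonneg, div_le_one htk]
        exact hak
      have e1 : 1 / t - 1 / t ^ 2 ≤ 1 / (t + 1) := by
        rw [div_sub_div _ _ htk.ne' (pow_pos htk 2).ne', div_le_div_iff₀ (by positivity)
          (by positivity)]
        nlinarith [pow_pos htk 2]
      have e2 : 1 / t ^ 2 - 2 / t ^ 3 ≤ 1 / (t + 1) ^ 2 := by
        rw [div_sub_div _ _ (pow_pos htk 2).ne' (pow_pos htk 3).ne',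
          div_le_div_iff₀ (by positivity) (by positivity)]
        nlinarith [pow_pos htk 2, pow_pos htk 3]
      have e3 : A' / t ^ 3 ≤ C * (a - 2) / t ^ 3 := by gcongr
      calc (1 - a / t) * D k + A / t ^ 2 + A' / t ^ 3
          ≤ (1 - a / t) * (A₁ / t + C * (1 / t ^ 2)) + A / t ^ 2 + C * (a - 2) / t ^ 3 := by gcongr
        _ = A₁ * (1 / t - 1 / t ^ 2) + C * (1 / t ^ 2 - 2 / t ^ 3) := by
            rw [← hA1]
            field_simp
            ring
        _ ≤ A₁ * (1 / (t + 1)) + C * (1 / (t + 1) ^ 2) := by gcongr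
        _ = _ := by ring
  obtain ⟨C', h⟩ := exists_forall_le_of_eventually_le
    (w := fun k : ℕ => 1 / (m + k) ^ 2) (fun k => by have := ht k; positivity) key
  exact ⟨C', fun k => by simpa only [mul_one_div, zero_add] using h k⟩

/-- A geometrically contracting recursion follows the decay `1 / (m + k)²` of its forcing term. -/
theorem le_div_sq_of_geometric_recursion {m r c : ℝ} (hm : 0 < m) (hr0 : 0 ≤ r) (hr : r < 1)
    {X : ℕ → ℝ} (hX : ∀ k : ℕ, X (k + 1) ≤ r * X k + c / (m + k) ^ 2) :
    ∃ C, ∀ k : ℕ, X k ≤ C / (m + k) ^ 2 := by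
  have ht : ∀ k : ℕ, 0 < m + k := fun k => by positivity
  obtain ⟨K, hK⟩ : ∃ K : ℕ, ∀ k : ℕ, K ≤ k →
      (1 + r) / 2 * ((1 + 1 / (m + k)) ^ 2) ≤ 1 := by
    have h1 : Tendsto (fun k : ℕ => (1 + r) / 2 * ((1 + 1 / (m + (k : ℝ))) ^ 2)) atTop
        (𝓝 ((1 + r) / 2 * ((1 + 0) ^ 2))) :=
      (((tendsto_const_div_add_natCast m 1).const_add 1).pow 2).const_mul _
    exact eventually_atTop.1 ((h1.eventually_lt_const (by linarith)).mono fun k hk => hk.le)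
  set C := max (max 0 (2 * c / (1 - r))) (X K * (m + K) ^ 2)
  have hC0 : 0 ≤ C := (le_max_left _ _).trans (le_max_left _ _)
  have hC1 : 2 * c ≤ C * (1 - r) := by
    rw [← div_le_iff₀ (by linarith)]
    exact (le_max_right _ _).trans (le_max_left _ _)
  have key : ∀ k, K ≤ k → X k ≤ 0 + C * (1 / (m + k) ^ 2) := by
    intro k hk
    induction k, hk using Nat.le_induction with
    | base =>
      rw [zero_add, mul_one_div, le_div_iff₀ (pow_pos (ht K) 2)]
      exact le_max_right _ _
    | succ k hk ih =>
      have htk := ht k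
      have h1 := hK k hk
      refine (hX k).trans ?_
      push_cast
      set t := m + (k : ℝ) with htdef
      rw [show m + ((k : ℝ) + 1) = t + 1 by rw [htdef]; ring]
      calc r * X k + c / t ^ 2 ≤ r * (0 + C * (1 / t ^ 2)) + (C * (1 - r) / 2) / t ^ 2 := by
            gcongr
            linarith
        _ = C * ((1 + r) / 2 * (1 + 1 / t) ^ 2) * (1 / (t + 1) ^ 2) := by
            field_simp
            ring
        _ ≤ C * 1 * (1 / (t + 1) ^ 2) := by gcongr
        _ = _ := by ring
  obtain ⟨C', h⟩ := exists_forall_le_of_eventually_le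
    (w := fun k : ℕ => 1 / (m + k) ^ 2) (fun k => by have := ht k; positivity) key
  exact ⟨C', fun k => by simpa only [mul_one_div, zero_add] using h k⟩

theorem bddAbove_of_geometric_recursion {r c : ℝ} (hr0 : 0 ≤ r) (hr : r < 1)
    {X : ℕ → ℝ} (hX : ∀ k : ℕ, X (k + 1) ≤ r * X k + c) : ∃ C, ∀ k : ℕ, X k ≤ C := by
  refine ⟨max (X 0) (c / (1 - r)), fun k => ?_⟩
  induction k with
  | zero => exact le_max_left _ _
  | succ k ih =>
    have h1 : c ≤ max (X 0) (c / (1 - r)) * (1 - r) := by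
      rw [← div_le_iff₀ (by linarith)]
      exact le_max_right _ _
    nlinarith [hX k, mul_le_mul_of_nonneg_left ih hr0]

theorem exists_forall_le_of_eventually_recursion {c l : ℝ} (hl : 0 < l) {V α : ℕ → ℝ} {K : ℕ}
    (hα : ∀ k, 0 ≤ α k) (hα' : ∀ k, K ≤ k → l * α k ≤ 1)
    (hV : ∀ k, K ≤ k → V (k + 1) ≤ (1 - l * α k) * V k + c * α k) :
    ∃ C, ∀ k, V k ≤ C := by
  have key : ∀ k, K ≤ k → V k ≤ 0 + max (V K) (c / l) * 1 := by
    intro k hk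
    rw [zero_add, mul_one]
    induction k, hk using Nat.le_induction with
    | base => exact le_max_left _ _
    | succ k hk ih =>
      have h1 : c ≤ max (V K) (c / l) * l := by
        rw [← div_le_iff₀ hl]
        exact le_max_right _ _
      nlinarith [hV k hk, mul_le_mul_of_nonneg_left ih (sub_nonneg.2 (hα' k hk)),
        mul_le_mul_of_nonneg_right h1 (hα k)]
  obtain ⟨C, h⟩ := exists_forall_le_of_eventually_le (b := fun _ => (0 : ℝ))
    (w := fun _ : ℕ => (1 : ℝ)) (fun _ => one_pos) key
  exact ⟨C, fun k => by simpa using h k⟩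

/-- One step of the Lyapunov function `d + x + η a u`, for a step-size `a` small enough that the
feedback terms are dominated by the contraction. -/
theorem lyapunov_step {r c lam s η a a' d d' x x' u u' h : ℝ} (a0 : 0 < a) (hc : 0 < c)
    (hη0 : 0 < η) (hs : 0 ≤ s) (hηc : η * c ^ 2 = lam / 4) (h1 : 1 * a ≤ 1)
    (h2 : (2 * c + c ^ 2) * a ≤ lam / 2) (h3 : (c + c ^ 2 + lam / 4 + lam / 4) * a ≤ 1 - r)
    (h4 : (c + η * (lam / 4)) * a ≤ η * (1 - r)) (d0 : 0 ≤ d) (x0 : 0 ≤ x) (u0 : 0 ≤ u)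
    (hU1 : 0 ≤ u') (hm1 : a' ≤ a)
    (hDk : d' ≤ (1 - lam * a + c * a ^ 2) * d + a ^ 2 * s + c * a * (x + a ^ 2 * (d + 1)))
    (hXk : x' ≤ r * x + c * a ^ 2 * (u + h)) (hUk : u' ≤ r * u + c * h)
    (hHk : h ≤ c * (1 + d + x)) :
    d' + x' + η * a' * u' ≤
      (1 - lam / 4 * a) * (d + x + η * a * u) + (s + c + c ^ 2 + lam / 4) * a := by
  have a1 : a ≤ 1 := by linarith
  have s1 : x' ≤ r * x + c * a ^ 2 * (u + c * (1 + d + x)) := by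
    refine hXk.trans ?_
    gcongr
  have s2 : η * a' * u' ≤ η * a * (r * u + c * (c * (1 + d + x))) := by
    calc η * a' * u' ≤ η * a * u' := by gcongr
      _ ≤ η * a * (r * u + c * (c * (1 + d + x))) := by
        gcongr
        exact hUk.trans (by gcongr)
  have aa : a ^ 2 ≤ a := by nlinarith
  have aaa : a ^ 3 ≤ a ^ 2 := by nlinarith [pow_pos a0 2]
  have p1 : (c * a ^ 2 + c * a ^ 3 + c ^ 2 * a ^ 2) * d ≤ (lam / 2) * a * d := by
    gcongr
    have := mul_le_mul_of_nonneg_right h2 a0.le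
    nlinarith [mul_le_mul_of_nonneg_left aaa hc.le]
  have p2 : (c * a + c ^ 2 * a ^ 2 + lam / 4 * a + lam / 4 * a) * x ≤ (1 - r) * x := by
    gcongr
    nlinarith [mul_le_mul_of_nonneg_left aa (pow_pos hc 2).le]
  have p3 : (c + η * (lam / 4)) * a * (a * u) ≤ η * (1 - r) * (a * u) := by
    gcongr
  have p4 : a ^ 2 * s + c * a ^ 3 + c ^ 2 * a ^ 2 ≤ (s + c + c ^ 2) * a := by
    nlinarith [mul_le_mul_of_nonneg_left aa hs, mul_le_mul_of_nonneg_left aa hc.le,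
      mul_le_mul_of_nonneg_left aaa hc.le, mul_le_mul_of_nonneg_left aa (pow_pos hc 2).le]
  have s3 : η * a * (r * u + c * (c * (1 + d + x))) =
      η * a * r * u + lam / 4 * a * (1 + d + x) := by
    rw [← hηc]
    ring
  rw [s3] at s2
  linarith only [hDk, s1, s2, p1, p2, p3, p4]

/-- The optimality gap `D`, the agreement error `X` and the size `U` of the tracking deviation
stay bounded. The Lyapunov function is `D + X + η α U`: the weight `η α` makes the feedback of `D`
through `U` smaller than the decrease `lam α D`. -/
theorem bounded_of_coupled_recursion {m θ r c lam s : ℝ} (hm : 0 < m) (hθ : 0 < θ)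
    (hr : r < 1) (hc : 0 < c) (hlam : 0 < lam) (hs : 0 ≤ s)
    {D X U H : ℕ → ℝ} (hD0 : ∀ k, 0 ≤ D k) (hX0 : ∀ k, 0 ≤ X k) (hU0 : ∀ k, 0 ≤ U k)
    (hX : ∀ k, X (k + 1) ≤ r * X k + c * decayingStep θ m k ^ 2 * (U k + H k))
    (hU : ∀ k, U (k + 1) ≤ r * U k + c * H k)
    (hH : ∀ k, H k ≤ c * (1 + D k + X k))
    (hD : ∀ k, D (k + 1) ≤
      (1 - lam * decayingStep θ m k + c * decayingStep θ m k ^ 2) * D k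
        + decayingStep θ m k ^ 2 * s
        + c * decayingStep θ m k * (X k + decayingStep θ m k ^ 2 * (D k + 1))) :
    ∃ M, ∀ k, D k ≤ M ∧ X k ≤ M := by
  have ht : ∀ k : ℕ, 0 < m + k := fun k => by positivity
  set α := decayingStep θ m with hα
  have hα0 : ∀ k, 0 < α k := fun k => div_pos hθ (ht k)
  have hαmono : ∀ k, α (k + 1) ≤ α k := fun k => by
    simp only [hα, decayingStep]
    have := ht k
    gcongr
    linarith
  have hlim : Tendsto α atTop (𝓝 0) := tendsto_const_div_add_natCast m θ
  set η := lam / (4 * c ^ 2) with hη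
  have hη0 : 0 < η := by positivity
  have hηc : η * c ^ 2 = lam / 4 := by
    rw [hη]
    field_simp
  have small : ∀ b d : ℝ, 0 < d → ∀ᶠ k in atTop, b * α k ≤ d := by
    intro b d hd
    have := hlim.const_mul b
    rw [mul_zero] at this
    exact (this.eventually_lt_const hd).mono fun k hk => hk.le
  obtain ⟨K, hK⟩ := eventually_atTop.1 ((small 1 1 one_pos).and ((small (2 * c + c ^ 2) (lam / 2)
    (by positivity)).and ((small (c + c ^ 2 + lam / 4 + lam / 4) (1 - r) (by linarith)).and
    ((small (c + η * (lam / 4)) (η * (1 - r)) (mul_pos hη0 (by linarith))).and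
    (small (lam / 4) 1 one_pos)))))
  obtain ⟨M, hM⟩ := exists_forall_le_of_eventually_recursion (l := lam / 4)
    (c := s + c + c ^ 2 + lam / 4) (V := fun k => D k + X k + η * α k * U k) (α := α) (K := K)
    (by positivity) (fun k => (hα0 k).le) (fun k hk => (hK k hk).2.2.2.2) (by
      intro k hk
      obtain ⟨h1, h2, h3, h4, -⟩ := hK k hk
      exact lyapunov_step (hα0 k) hc hη0 hs hηc h1 h2 h3 h4 (hD0 k) (hX0 k) (hU0 k) (hU0 (k + 1))
        (hαmono k) (hD k) (hX k) (hU k) (hH k))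
  refine ⟨M, fun k => ?_⟩
  have h1 := hM k
  have h2 : 0 ≤ η * α k * U k := mul_nonneg (mul_nonneg hη0.le (hα0 k).le) (hU0 k)
  constructor <;> linarith [hD0 k, hX0 k]

/-- Decay rates in the coupled recursion for the optimality gap `D`, the agreement error `X` and
the tracking deviation `U`. Since the contraction exponent `lam * θ` exceeds `2`, the agreement
error, which enters `D` at order `1 / (m + k)³`, does not influence the leading term. -/
theorem rates_of_coupled_recursion {m θ r c lam s : ℝ} (hm : 0 < m) (hθ : 0 < θ)
    (hr0 : 0 ≤ r) (hr : r < 1) (hc : 0 < c) (hlam : 2 < lam * θ) (hs : 0 ≤ s)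
    {D X U H : ℕ → ℝ} (hD0 : ∀ k, 0 ≤ D k) (hX0 : ∀ k, 0 ≤ X k) (hU0 : ∀ k, 0 ≤ U k)
    (hX : ∀ k, X (k + 1) ≤ r * X k + c * decayingStep θ m k ^ 2 * (U k + H k))
    (hU : ∀ k, U (k + 1) ≤ r * U k + c * H k)
    (hH : ∀ k, H k ≤ c * (1 + D k + X k))
    (hD : ∀ k, D (k + 1) ≤
      (1 - lam * decayingStep θ m k + c * decayingStep θ m k ^ 2) * D k
        + decayingStep θ m k ^ 2 * s
        + c * decayingStep θ m k * (X k + decayingStep θ m k ^ 2 * (D k + 1))) :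
    (∃ C, ∀ k : ℕ, X k ≤ C / (m + k) ^ 2) ∧
      ∃ C, ∀ k : ℕ, D k ≤ θ ^ 2 * s / (lam * θ - 1) / (m + k) + C / (m + k) ^ 2 := by
  have ht : ∀ k : ℕ, 0 < m + k := fun k => by positivity
  have hlam0 : 0 < lam := by
    by_contra h
    nlinarith
  obtain ⟨M, hM⟩ := bounded_of_coupled_recursion hm hθ hr hc hlam0 hs hD0 hX0 hU0 hX hU hH hD
  have hM0 : 0 ≤ M := (hD0 0).trans (hM 0).1
  have hHb : ∀ k, H k ≤ c * (1 + M + M) := fun k => (hH k).trans (by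
    have := hM k
    gcongr
    exacts [this.1, this.2])
  obtain ⟨N, hN⟩ := bddAbove_of_geometric_recursion hr0 hr (c := c * (c * (1 + M + M)))
    (fun k => (hU k).trans (by have := hHb k; gcongr))
  obtain ⟨CX, hCX⟩ := le_div_sq_of_geometric_recursion hm hr0 hr
    (c := c * θ ^ 2 * (N + c * (1 + M + M))) (X := X) (fun k => (hX k).trans (by
      have h1 : U k + H k ≤ N + c * (1 + M + M) := add_le_add (hN k) (hHb k)
      have h2 : c * θ ^ 2 * (N + c * (1 + M + M)) / (m + k) ^ 2 =
          c * decayingStep θ m k ^ 2 * (N + c * (1 + M + M)) := by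
        rw [decayingStep, div_pow]
        ring
      rw [h2]
      gcongr))
  refine ⟨⟨CX, hCX⟩, ?_⟩
  -- a first application gives `D = O(1 / (m + k))`, a second one the exact leading constant
  have step : ∀ k : ℕ, D (k + 1) ≤ (1 - lam * θ / (m + k)) * D k + θ ^ 2 * s / (m + k) ^ 2
      + c * θ ^ 2 * D k / (m + k) ^ 2 + c * θ * (CX + θ ^ 2 * (M + 1)) / (m + k) ^ 3 := by
    intro k
    refine (hD k).trans ?_
    have htk := ht k
    have h1 : X k + decayingStep θ m k ^ 2 * (D k + 1) ≤ (CX + θ ^ 2 * (M + 1)) / (m + k) ^ 2 := by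
      rw [decayingStep, div_pow, add_div, mul_div_right_comm]
      have := hCX k
      have := (hM k).1
      gcongr
    have h2 : 0 ≤ c * decayingStep θ m k := mul_nonneg hc.le (div_pos hθ htk).le
    refine (add_le_add_right (mul_le_mul_of_nonneg_left h1 h2) _).trans (le_of_eq ?_)
    rw [decayingStep]
    field_simp
    ring
  obtain ⟨C₁, hC₁⟩ := le_of_recursion_one_sub_div hm hlam (D := D)
    (A := θ ^ 2 * s + c * θ ^ 2 * M) (A' := c * θ * (CX + θ ^ 2 * (M + 1))) (by positivity)
    (fun k => (step k).trans (by
      have htk := ht k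
      rw [add_div (θ ^ 2 * s), ← add_assoc]
      have := (hM k).1
      gcongr))
  set A₁ := (θ ^ 2 * s + c * θ ^ 2 * M) / (lam * θ - 1)
  have hC₂ : ∀ k : ℕ, D k ≤ (A₁ + |C₁| / m) / (m + k) := by
    intro k
    refine (hC₁ k).trans ?_
    have htk := ht k
    have h1 : C₁ / (m + k) ^ 2 ≤ |C₁| / m / (m + k) := by
      rw [div_div, pow_two]
      have : m ≤ m + k := by simp
      gcongr
      exact le_abs_self _
    rw [add_div]
    linarith
  exact le_of_recursion_one_sub_div hm hlam (D := D) (A := θ ^ 2 * s)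
    (A' := c * θ ^ 2 * (A₁ + |C₁| / m) + c * θ * (CX + θ ^ 2 * (M + 1))) (by positivity)
    (fun k => (step k).trans (by
      have htk := ht k
      rw [add_div (c * θ ^ 2 * (A₁ + |C₁| / m)), ← add_assoc]
      have h1 : c * θ ^ 2 * D k / (m + k) ^ 2 ≤ c * θ ^ 2 * (A₁ + |C₁| / m) / (m + k) ^ 3 := by
        calc c * θ ^ 2 * D k / (m + k) ^ 2
            ≤ c * θ ^ 2 * ((A₁ + |C₁| / m) / (m + k)) / (m + k) ^ 2 := by
              have := hC₂ k
              gcongr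
          _ = _ := by
              rw [mul_div_assoc', div_div]
              ring
      gcongr))

/-! ### The network -/

section Network

variable {n p : ℕ}

/-- The action of an `n × n` matrix on a family of `n` vectors, that is, of the Kronecker product
`M ⊗ I_p` on the stacked vector. -/
noncomputable def blockMul (M : Matrix (Fin n) (Fin n) ℝ) (x : Fin n → EuclideanSpace ℝ (Fin p)) :
    Fin n → EuclideanSpace ℝ (Fin p) :=
  fun i => ∑ j, M i j • x j

theorem toEuclideanCLM_piScaled_toLp {v : Fin n → ℝ} (hv : ∀ i, 0 < v i)
    (M : Matrix (Fin n) (Fin n) ℝ) (t : Fin n → ℝ) :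
    Matrix.toEuclideanCLM (n := Fin n) (𝕜 := ℝ)
        (Matrix.diagonal (fun i => (√(v i))⁻¹) * M * Matrix.diagonal (fun i => √(v i)))
        (WithLp.toLp 2 fun i => t i / √(v i)) = WithLp.toLp 2 fun i => M.mulVec t i / √(v i) := by
  rw [Matrix.toEuclideanCLM_toLp]
  congr 1
  funext i
  have h : (Matrix.diagonal fun i => √(v i)).mulVec (fun i => t i / √(v i)) = t := by
    funext j
    rw [Matrix.mulVec_diagonal]
    exact mul_div_cancel₀ _ (Real.sqrt_pos.2 (hv j)).ne'
  rw [← Matrix.mulVec_mulVec, h, ← Matrix.mulVec_mulVec, Matrix.mulVec_diagonal]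
  ring

theorem norm_toLp_div_sqrt_sq {v : Fin n → ℝ} (hv : ∀ i, 0 < v i) (t : Fin n → ℝ) :
    ‖(WithLp.toLp 2 fun i => t i / √(v i) : EuclideanSpace ℝ (Fin n))‖ ^ 2 =
      ∑ i, t i ^ 2 / v i := by
  rw [EuclideanSpace.norm_sq_eq]
  refine Finset.sum_congr rfl fun i _ => ?_
  rw [Real.norm_eq_abs, sq_abs, div_pow, Real.sq_sqrt (hv i).le]

theorem sum_mulVec_sq_div_le {v : Fin n → ℝ} (hv : ∀ i, 0 < v i)
    (M : Matrix (Fin n) (Fin n) ℝ) (t : Fin n → ℝ) :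
    ∑ i, M.mulVec t i ^ 2 / v i ≤ piMatrixNorm v M ^ 2 * ∑ i, t i ^ 2 / v i := by
  rw [← norm_toLp_div_sqrt_sq hv, ← norm_toLp_div_sqrt_sq hv,
    ← toEuclideanCLM_piScaled_toLp hv, ← mul_pow]
  gcongr
  exact ContinuousLinearMap.le_opNorm _ _

theorem piNormSq_nonneg {v : Fin n → ℝ} (hv : ∀ i, 0 < v i)
    (x : Fin n → EuclideanSpace ℝ (Fin p)) : 0 ≤ piNormSq v x :=
  Finset.sum_nonneg fun i _ => div_nonneg (sq_nonneg _) (hv i).le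

theorem piNormSq_eq_sum_coord (v : Fin n → ℝ) (x : Fin n → EuclideanSpace ℝ (Fin p)) :
    piNormSq v x = ∑ c, ∑ i, x i c ^ 2 / v i := by
  rw [Finset.sum_comm]
  refine Finset.sum_congr rfl fun i _ => ?_
  rw [EuclideanSpace.norm_sq_eq, Finset.sum_div]
  simp only [Real.norm_eq_abs, sq_abs]

theorem piNormSq_blockMul_le {v : Fin n → ℝ} (hv : ∀ i, 0 < v i)
    (M : Matrix (Fin n) (Fin n) ℝ) (x : Fin n → EuclideanSpace ℝ (Fin p)) :
    piNormSq v (blockMul M x) ≤ piMatrixNorm v M ^ 2 * piNormSq v x := by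
  rw [piNormSq_eq_sum_coord, piNormSq_eq_sum_coord, Finset.mul_sum]
  refine Finset.sum_le_sum fun c _ => ?_
  refine le_trans (le_of_eq ?_) (sum_mulVec_sq_div_le hv M fun j => x j c)
  refine Finset.sum_congr rfl fun i _ => ?_
  simp [blockMul, Matrix.mulVec, dotProduct]

theorem norm_add_sq_le_of_pos {F : Type*} [SeminormedAddCommGroup F] (a b : F) {t : ℝ}
    (ht : 0 < t) : ‖a + b‖ ^ 2 ≤ (1 + t) * ‖a‖ ^ 2 + (1 + 1 / t) * ‖b‖ ^ 2 := by
  have h1 : ‖a + b‖ ^ 2 ≤ (‖a‖ + ‖b‖) ^ 2 := by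
    gcongr
    exact norm_add_le a b
  have h2 : 2 * ‖a‖ * ‖b‖ ≤ t * ‖a‖ ^ 2 + 1 / t * ‖b‖ ^ 2 := by
    have := div_nonneg (sq_nonneg (t * ‖a‖ - ‖b‖)) ht.le
    have e : (t * ‖a‖ - ‖b‖) ^ 2 / t = t * ‖a‖ ^ 2 - 2 * ‖a‖ * ‖b‖ + 1 / t * ‖b‖ ^ 2 := by
      field_simp
      ring
    linarith
  nlinarith

theorem norm_add_sq_le_two {F : Type*} [SeminormedAddCommGroup F] (a b : F) :
    ‖a + b‖ ^ 2 ≤ 2 * ‖a‖ ^ 2 + 2 * ‖b‖ ^ 2 := by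
  have := norm_add_sq_le_of_pos a b one_pos
  norm_num at this
  exact this

theorem piNormSq_add_le {v : Fin n → ℝ} (hv : ∀ i, 0 < v i)
    (x y : Fin n → EuclideanSpace ℝ (Fin p)) {t : ℝ} (ht : 0 < t) :
    piNormSq v (fun i => x i + y i) ≤ (1 + t) * piNormSq v x + (1 + 1 / t) * piNormSq v y := by
  simp only [piNormSq, Finset.mul_sum, ← Finset.sum_add_distrib]
  refine Finset.sum_le_sum fun i _ => ?_
  rw [mul_div_assoc', mul_div_assoc', ← add_div]
  have := hv i
  gcongr
  exact norm_add_sq_le_of_pos _ _ ht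

theorem piNormSq_smul (v : Fin n → ℝ) (a : ℝ) (x : Fin n → EuclideanSpace ℝ (Fin p)) :
    piNormSq v (fun i => a • x i) = a ^ 2 * piNormSq v x := by
  simp only [piNormSq, Finset.mul_sum, norm_smul, mul_pow, Real.norm_eq_abs, sq_abs, mul_div_assoc]

variable {G : Digraph (Fin n)} {B : Matrix (Fin n) (Fin n) ℝ} {v : Fin n → ℝ}

theorem IsPerronVector.le_one (hv : IsPerronVector B v) (i : Fin n) : v i ≤ 1 := by
  rw [← hv.sum_eq_one]
  exact Finset.single_le_sum (f := v) (fun j _ => (hv.pos j).le) (Finset.mem_univ i)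

theorem IsPerronVector.card_pos (hv : IsPerronVector B v) : 0 < n := by
  rcases Nat.eq_zero_or_pos n with rfl | h
  · simpa using hv.sum_eq_one
  · exact h

theorem IsPerronVector.sum_mul (hv : IsPerronVector B v) (i : Fin n) : ∑ j, B i j * v j = v i :=
  congrFun hv.eigen i

theorem IsWeightMatrix.nonneg (hB : IsWeightMatrix G B) (i j : Fin n) : 0 ≤ B i j := by
  by_cases h : G.Adj i j
  · exact (hB.pos i j h).le
  · exact (hB.zero i j h).ge

theorem IsWeightMatrix.sum_mulVec (hB : IsWeightMatrix G B) (t : Fin n → ℝ) :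
    ∑ i, B.mulVec t i = ∑ i, t i := by
  simp only [Matrix.mulVec, dotProduct]
  rw [Finset.sum_comm]
  simp only [← Finset.sum_mul, hB.col_sum, one_mul]

theorem limitMatrix_mulVec (v t : Fin n → ℝ) (i : Fin n) :
    (limitMatrix v).mulVec t i = v i * ∑ j, t j := by
  simp [limitMatrix, Matrix.mulVec, dotProduct, Finset.mul_sum]

/-- The loss of the `π`-norm under `B` as a Dirichlet form: each row of `diag(π)⁻¹ B diag(π)` is a
probability vector, and the loss is the sum of the variances of `t / π` under these rows. -/
theorem sum_sq_div_sub_sum_mulVec_sq_div (hB : IsWeightMatrix G B) (hv : IsPerronVector B v)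
    (t : Fin n → ℝ) :
    ∑ i, t i ^ 2 / v i - ∑ i, B.mulVec t i ^ 2 / v i =
      ∑ i, ∑ j, B i j * v j * (t j / v j - B.mulVec t i / v i) ^ 2 := by
  have hv0 := fun i => (hv.pos i).ne'
  have h1 : ∀ i, ∑ j, B i j * v j * (t j / v j - B.mulVec t i / v i) ^ 2 =
      ∑ j, B i j * (t j ^ 2 / v j) - B.mulVec t i ^ 2 / v i := by
    intro i
    have h2 : ∀ j, B i j * v j * (t j / v j - B.mulVec t i / v i) ^ 2 =
        B i j * (t j ^ 2 / v j) - 2 * (B.mulVec t i / v i) * (B i j * t j)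
          + (B.mulVec t i / v i) ^ 2 * (B i j * v j) := by
      intro j
      have := hv0 j
      have := hv0 i
      field_simp
      ring
    simp only [h2, Finset.sum_add_distrib, Finset.sum_sub_distrib, ← Finset.mul_sum]
    rw [hv.sum_mul i, show ∑ j, B i j * t j = B.mulVec t i from rfl]
    have := hv0 i
    field_simp
    ring
  simp only [h1, Finset.sum_sub_distrib]
  congr 1
  rw [Finset.sum_comm]
  simp only [← Finset.sum_mul, hB.col_sum, one_mul]

/-- If `B` preserves the `π`-norm of `t`, then `t / π` is constant along the edges, the self-loops
linking a node to its in-neighbours, so that `t` is a multiple of `π`. -/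
theorem exists_eq_smul_of_sum_mulVec_sq_div_ge (hG : IsStronglyConnectedNetwork G)
    (hB : IsWeightMatrix G B) (hv : IsPerronVector B v) {t : Fin n → ℝ}
    (ht : ∑ i, t i ^ 2 / v i ≤ ∑ i, B.mulVec t i ^ 2 / v i) : ∃ c, ∀ i, t i = c * v i := by
  have h0 : ∀ i j, 0 ≤ B i j * v j * (t j / v j - B.mulVec t i / v i) ^ 2 := fun i j =>
    mul_nonneg (mul_nonneg (hB.nonneg i j) (hv.pos j).le) (sq_nonneg _)
  have h1 : ∑ i, ∑ j, B i j * v j * (t j / v j - B.mulVec t i / v i) ^ 2 = 0 :=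
    le_antisymm (by rw [← sum_sq_div_sub_sum_mulVec_sq_div hB hv]; linarith)
      (Finset.sum_nonneg fun i _ => Finset.sum_nonneg fun j _ => h0 i j)
  have h2 : ∀ i j, G.Adj i j → t j / v j = B.mulVec t i / v i := by
    intro i j hij
    rw [Finset.sum_eq_zero_iff_of_nonneg
      (fun i _ => Finset.sum_nonneg fun j _ => h0 i j)] at h1
    have h3 := h1 i (Finset.mem_univ i)
    rw [Finset.sum_eq_zero_iff_of_nonneg (fun j _ => h0 i j)] at h3
    have h4 := h3 j (Finset.mem_univ j)
    have h5 : B i j * v j ≠ 0 := (mul_pos (hB.pos i j hij) (hv.pos j)).ne'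
    have h6 := (mul_eq_zero.1 h4).resolve_left h5
    exact sub_eq_zero.1 (pow_eq_zero_iff two_ne_zero |>.1 h6)
  have h3 : ∀ i j, Relation.ReflTransGen G.Adj i j → t j / v j = t i / v i := by
    intro i j hij
    induction hij with
    | refl => rfl
    | tail _ hbc ih => rw [h2 _ _ hbc, ← h2 _ _ (hG.self_adj _), ih]
  refine ⟨t ⟨0, hv.card_pos⟩ / v ⟨0, hv.card_pos⟩, fun i => ?_⟩
  rw [← h3 _ i (hG.connected _ i), div_mul_cancel₀ _ (hv.pos i).ne']

theorem sum_sub_limitMatrix_mulVec_sq_div_lt (hG : IsStronglyConnectedNetwork G)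
    (hB : IsWeightMatrix G B) (hv : IsPerronVector B v) {t : Fin n → ℝ} (ht : t ≠ 0) :
    ∑ i, (B - limitMatrix v).mulVec t i ^ 2 / v i < ∑ i, t i ^ 2 / v i := by
  have h1 : ∑ i, (B - limitMatrix v).mulVec t i ^ 2 / v i =
      ∑ i, B.mulVec t i ^ 2 / v i - (∑ i, t i) ^ 2 := by
    have h2 : ∀ i, (B - limitMatrix v).mulVec t i ^ 2 / v i =
        B.mulVec t i ^ 2 / v i - 2 * (∑ j, t j) * B.mulVec t i + (∑ j, t j) ^ 2 * v i := by
      intro i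
      have := (hv.pos i).ne'
      rw [Matrix.sub_mulVec, Pi.sub_apply, limitMatrix_mulVec]
      field_simp
      ring
    simp only [h2, Finset.sum_add_distrib, Finset.sum_sub_distrib, ← Finset.mul_sum]
    rw [hB.sum_mulVec, hv.sum_eq_one]
    ring
  rw [h1]
  by_contra! hcon
  obtain ⟨c, hc⟩ := exists_eq_smul_of_sum_mulVec_sq_div_ge hG hB hv (t := t)
    (by linarith [sq_nonneg (∑ i, t i)])
  have h2 : ∑ i, t i = c := by
    simp only [hc, ← Finset.mul_sum, hv.sum_eq_one, mul_one]
  have h3 := sum_sq_div_sub_sum_mulVec_sq_div hB hv t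
  have h4 : 0 ≤ ∑ i, ∑ j, B i j * v j * (t j / v j - B.mulVec t i / v i) ^ 2 :=
    Finset.sum_nonneg fun i _ => Finset.sum_nonneg fun j _ =>
      mul_nonneg (mul_nonneg (hB.nonneg i j) (hv.pos j).le) (sq_nonneg _)
  have h5 : c ^ 2 ≤ 0 := by
    rw [← h2]
    linarith
  have h6 : c = 0 := by nlinarith
  exact ht (funext fun i => by simp [hc, h6])

theorem sigmaB_nonneg (B : Matrix (Fin n) (Fin n) ℝ) (v : Fin n → ℝ) : 0 ≤ sigmaB B v :=
  norm_nonneg _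

theorem norm_lt_one_of_forall_norm_lt {F : Type*} [NormedAddCommGroup F] [NormedSpace ℝ F]
    [FiniteDimensional ℝ F] (T : F →L[ℝ] F) (h : ∀ u, u ≠ 0 → ‖T u‖ < ‖u‖) : ‖T‖ < 1 := by
  rcases subsingleton_or_nontrivial F with hF | hF
  · rw [Subsingleton.elim T 0, norm_zero]
    exact one_pos
  have : ProperSpace F := FiniteDimensional.proper_real F
  obtain ⟨u, hu, hmax⟩ := (isCompact_sphere (0 : F) 1).exists_isMaxOn
    (NormedSpace.sphere_nonempty.2 zero_le_one) (f := fun u => ‖T u‖) (by fun_prop)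
  have hu1 : ‖u‖ = 1 := by simpa using hu
  have hu0 : u ≠ 0 := by
    rintro rfl
    simp at hu1
  refine lt_of_le_of_lt (ContinuousLinearMap.opNorm_le_of_unit_norm (norm_nonneg (T u))
    fun w hw => hmax (by simpa using hw)) ?_
  rw [← hu1]
  exact h u hu0

/-- The mixing rate of a strongly connected network with self-loops is less than one. -/
theorem sigmaB_lt_one (hG : IsStronglyConnectedNetwork G)
    (hB : IsWeightMatrix G B) (hv : IsPerronVector B v) : sigmaB B v < 1 := by
  refine norm_lt_one_of_forall_norm_lt _ fun u hu => ?_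
  set t : Fin n → ℝ := fun i => u i * √(v i) with ht
  have hut : u = WithLp.toLp 2 fun i => t i / √(v i) := by
    ext i
    simp only [ht]
    rw [mul_div_cancel_right₀ _ (Real.sqrt_pos.2 (hv.pos i)).ne']
  have ht0 : t ≠ 0 := by
    intro h
    apply hu
    rw [hut, h]
    ext i
    simp
  refine lt_of_pow_lt_pow_left₀ 2 (norm_nonneg _) ?_
  rw [hut, toEuclideanCLM_piScaled_toLp hv.pos, norm_toLp_div_sqrt_sq hv.pos,
    norm_toLp_div_sqrt_sq hv.pos]
  exact sum_sub_limitMatrix_mulVec_sq_div_lt hG hB hv ht0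

theorem exists_sigmaB_pow_le (hG : IsStronglyConnectedNetwork G) (hB : IsWeightMatrix G B)
    (hv : IsPerronVector B v) {m : ℝ} (hm : 0 < m) :
    ∃ S : ℕ, ∀ k : ℕ, S ≤ k → sigmaB B v ^ k ≤ 1 / (n * (m + k) ^ 2) := by
  have hs0 := sigmaB_nonneg B v
  have hs1 := sigmaB_lt_one hG hB hv
  have hn : (0 : ℝ) < n := by exact_mod_cast hv.card_pos
  have h1 := tendsto_pow_const_mul_const_pow_of_abs_lt_one 2
    (show |sigmaB B v| < 1 by rwa [abs_of_nonneg hs0])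
  have h2 : (0 : ℝ) < 1 / (n * (m + 1) ^ 2) := by positivity
  obtain ⟨S, hS⟩ := eventually_atTop.1 (h1.eventually_lt_const h2)
  refine ⟨max S 1, fun k hk => ?_⟩
  have h3 := hS k (le_of_max_le_left hk)
  have hk1 : (1 : ℝ) ≤ k := by exact_mod_cast le_of_max_le_right hk
  rw [lt_div_iff₀ (by positivity)] at h3
  rw [le_div_iff₀ (by positivity)]
  have h4 : (m + k) ^ 2 ≤ ((m + 1) * k) ^ 2 := by
    gcongr
    nlinarith
  calc sigmaB B v ^ k * (n * (m + k) ^ 2) ≤ sigmaB B v ^ k * (n * ((m + 1) * k) ^ 2) := by gcongr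
    _ = (k : ℝ) ^ 2 * sigmaB B v ^ k * (n * (m + 1) ^ 2) := by ring
    _ ≤ 1 := h3.le

theorem le_yIter (hB : IsWeightMatrix G B) (hv : IsPerronVector B v) (k : ℕ) (i : Fin n) :
    v i ≤ yIter B k i := by
  induction k generalizing i with
  | zero => exact hv.le_one i
  | succ k ih =>
    rw [← hv.sum_mul i]
    exact Finset.sum_le_sum fun j _ => mul_le_mul_of_nonneg_left (ih j) (hB.nonneg i j)

theorem sum_yIter (hB : IsWeightMatrix G B) (k : ℕ) : ∑ i, yIter B k i = n := by
  induction k with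
  | zero => simp [yIter]
  | succ k ih => exact (hB.sum_mulVec _).trans ih

theorem sum_yIter_sub_sq_div_le (hB : IsWeightMatrix G B) (hv : IsPerronVector B v) (k : ℕ) :
    ∑ i, (yIter B k i - n * v i) ^ 2 / v i ≤
      (sigmaB B v ^ 2) ^ k * ∑ i, (1 - n * v i) ^ 2 / v i := by
  induction k with
  | zero => simp [yIter]
  | succ k ih =>
    have h1 : ∀ i, yIter B (k + 1) i - n * v i =
        (B - limitMatrix v).mulVec (fun j => yIter B k j - n * v j) i := by
      intro i
      rw [Matrix.sub_mulVec, Pi.sub_apply, limitMatrix_mulVec, Finset.sum_sub_distrib,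
        sum_yIter hB, ← Finset.mul_sum, hv.sum_eq_one]
      have : B.mulVec (fun j => yIter B k j - n * v j) i = yIter B (k + 1) i - n * v i := by
        simp only [yIter, Matrix.mulVec, dotProduct, mul_sub, Finset.sum_sub_distrib]
        rw [← hv.sum_mul i, Finset.mul_sum]
        congr 1
        exact Finset.sum_congr rfl fun j _ => by ring
      rw [this]
      ring
    simp only [h1]
    refine (sum_mulVec_sq_div_le hv.pos _ _).trans ?_
    rw [pow_succ' (sigmaB B v ^ 2), mul_assoc]
    exact mul_le_mul_of_nonneg_left ih (sq_nonneg _)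

theorem exists_div_yIter_sub_one_sq_le (hG : IsStronglyConnectedNetwork G)
    (hB : IsWeightMatrix G B) (hv : IsPerronVector B v) {m : ℝ} (hm : 0 < m) :
    ∃ R, 0 ≤ R ∧ ∀ (k : ℕ) i, (n * v i / yIter B k i - 1) ^ 2 ≤ R / (m + k) ^ 2 := by
  have hs0 := sigmaB_nonneg B v
  have hs1 := sigmaB_lt_one hG hB hv
  obtain ⟨C, hC⟩ := le_div_sq_of_geometric_recursion hm (sq_nonneg (sigmaB B v))
    (by nlinarith) (c := 0) (X := fun k => (sigmaB B v ^ 2) ^ k) (fun k => by rw [pow_succ']; simp)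
  set N := ∑ i, (1 - n * v i) ^ 2 / v i
  have hN0 : 0 ≤ N := Finset.sum_nonneg fun i _ => div_nonneg (sq_nonneg _) (hv.pos i).le
  set V := ∑ i, (v i)⁻¹
  have hV0 : 0 ≤ V := Finset.sum_nonneg fun i _ => inv_nonneg.2 (hv.pos i).le
  refine ⟨V * (|C| * N), by positivity, fun k i => ?_⟩
  have hv0 := hv.pos i
  have hy := le_yIter hB hv k i
  have hy0 := hv0.trans_le hy
  have h1 : (yIter B k i - n * v i) ^ 2 / v i ≤ |C| / (m + k) ^ 2 * N := by
    refine (Finset.single_le_sum (f := fun i => (yIter B k i - n * v i) ^ 2 / v i)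
      (fun j _ => div_nonneg (sq_nonneg _) (hv.pos j).le) (Finset.mem_univ i)).trans ?_
    refine (sum_yIter_sub_sq_div_le hB hv k).trans ?_
    gcongr
    refine (hC k).trans ?_
    gcongr
    exact le_abs_self C
  have h2 : (v i)⁻¹ ≤ V := Finset.single_le_sum (f := fun i => (v i)⁻¹)
    (fun j _ => inv_nonneg.2 (hv.pos j).le) (Finset.mem_univ i)
  calc (n * v i / yIter B k i - 1) ^ 2 = (yIter B k i - n * v i) ^ 2 / yIter B k i ^ 2 := by
        field_simp
        ring
    _ ≤ (yIter B k i - n * v i) ^ 2 / v i ^ 2 := by gcongr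
    _ = (v i)⁻¹ * ((yIter B k i - n * v i) ^ 2 / v i) := by
        field_simp
    _ ≤ V * (|C| / (m + k) ^ 2 * N) := by
        gcongr
    _ = V * (|C| * N) / (m + k) ^ 2 := by ring

end Network

/-! ### Gradient steps -/

section Gradient

variable {n p : ℕ}

theorem norm_mean_sq_le (x : Fin n → EuclideanSpace ℝ (Fin p)) :
    ‖mean x‖ ^ 2 ≤ ∑ i, ‖x i‖ ^ 2 := by
  rcases Nat.eq_zero_or_pos n with rfl | hn
  · simp [mean]
  have hn' : (1 : ℝ) ≤ n := by exact_mod_cast hn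
  have h1 : ‖∑ i, x i‖ ^ 2 ≤ n * ∑ i, ‖x i‖ ^ 2 := by
    calc ‖∑ i, x i‖ ^ 2 ≤ (∑ i, ‖x i‖) ^ 2 := by
          gcongr
          exact norm_sum_le _ _
      _ ≤ n * ∑ i, ‖x i‖ ^ 2 := by
          simpa using sq_sum_le_card_mul_sum_sq (s := Finset.univ) (f := fun i => ‖x i‖)
  have h2 : 0 ≤ ∑ i, ‖x i‖ ^ 2 := Finset.sum_nonneg fun i _ => sq_nonneg _
  rw [mean, norm_smul, mul_pow, Real.norm_eq_abs, sq_abs, div_pow, one_pow, one_div_mul_eq_div,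
    div_le_iff₀ (by positivity)]
  nlinarith

theorem mean_sub (x y : Fin n → EuclideanSpace ℝ (Fin p)) :
    mean (fun i => x i - y i) = mean x - mean y := by
  simp [mean, Finset.sum_sub_distrib, smul_sub]

/-- The Lipschitz constant is not the optimal `l`; any multiple of `l` serves. The bound compares
the quadratic upper model at `x` with the tangent at `y`, at the point
`y + (∇f y - ∇f x) / (2 l)`. -/
theorem IsStronglyConvexSmooth.norm_gradient_sub_le {μ l : ℝ} (hμ : 0 < μ) (hl : 0 < l)
    {f : EuclideanSpace ℝ (Fin p) → ℝ} (hf : IsStronglyConvexSmooth μ l f)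
    (x y : EuclideanSpace ℝ (Fin p)) :
    ‖gradient f y - gradient f x‖ ≤ 2 * l * ‖y - x‖ := by
  set d := gradient f y - gradient f x with hd
  set w := y + (1 / (2 * l)) • d with hw
  have h1 := hf.upper x w
  have h2 := hf.lower y w
  have h3 := hf.lower x y
  have h4 : 0 ≤ μ / 2 * ‖y - w‖ ^ 2 := by positivity
  have h5 : 0 ≤ μ / 2 * ‖x - y‖ ^ 2 := by positivity
  have e1 : w - y = (1 / (2 * l)) • d := by rw [hw]; abel
  have e2 : w - x = (y - x) + (1 / (2 * l)) • d := by rw [hw]; abel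
  have h6 : inner ℝ (gradient f y) (w - y) + inner ℝ (gradient f x) (y - x)
      - inner ℝ (gradient f x) (w - x) = 1 / (2 * l) * ‖d‖ ^ 2 := by
    rw [e1, e2, inner_add_right, ← real_inner_self_eq_norm_sq d]
    nth_rewrite 4 [hd]
    rw [inner_sub_left, inner_smul_right, inner_smul_right]
    ring
  have h7 : ‖x - w‖ ^ 2 ≤ 2 * ‖y - x‖ ^ 2 + 2 * (1 / (2 * l) * ‖d‖) ^ 2 := by
    rw [norm_sub_rev, e2]
    have := norm_add_sq_le_two (y - x) ((1 / (2 * l)) • d)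
    rwa [norm_smul (1 / (2 * l)) d, Real.norm_eq_abs, abs_of_pos (by positivity)] at this
  have h8 : 1 / (2 * l) * ‖d‖ ^ 2 ≤ l / 2 * (2 * ‖y - x‖ ^ 2 + 2 * (1 / (2 * l) * ‖d‖) ^ 2) := by
    have := mul_le_mul_of_nonneg_left h7 (by positivity : 0 ≤ l / 2)
    linarith
  have h9 : ‖d‖ ^ 2 ≤ (2 * l * ‖y - x‖) ^ 2 := by
    have e3 : l / 2 * (2 * ‖y - x‖ ^ 2 + 2 * (1 / (2 * l) * ‖d‖) ^ 2) =
        l * ‖y - x‖ ^ 2 + 1 / (4 * l) * ‖d‖ ^ 2 := by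
      field_simp
      ring
    have e4 : 1 / (2 * l) * ‖d‖ ^ 2 = 1 / (4 * l) * ‖d‖ ^ 2 + 1 / (4 * l) * ‖d‖ ^ 2 := by
      field_simp
      ring
    have h10 : 1 / (4 * l) * ‖d‖ ^ 2 ≤ l * ‖y - x‖ ^ 2 := by linarith
    rw [one_div_mul_eq_div, div_le_iff₀ (by positivity)] at h10
    linarith
  exact le_of_sq_le_sq h9 (by positivity)

theorem IsStronglyConvexSmooth.mul_norm_sq_le_inner {μ l : ℝ}
    {f : EuclideanSpace ℝ (Fin p) → ℝ} (hf : IsStronglyConvexSmooth μ l f)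
    (x y : EuclideanSpace ℝ (Fin p)) :
    μ * ‖x - y‖ ^ 2 ≤ inner ℝ (x - y) (gradient f x - gradient f y) := by
  have h1 := hf.lower x y
  have h2 := hf.lower y x
  rw [norm_sub_rev y x] at h2
  rw [real_inner_comm, inner_sub_left]
  rw [← neg_sub x y, inner_neg_right] at h1
  linarith

variable {μ l : ℝ} {f : Fin n → EuclideanSpace ℝ (Fin p) → ℝ} {zstar : EuclideanSpace ℝ (Fin p)}

/-- The average gradient vanishes at a minimizer, because a step of length `1 / l` along it would
otherwise decrease the global cost. -/
theorem mean_gradient_eq_zero_of_isMin (hn : 0 < n) (hl : 0 < l)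
    (hf : ∀ i, IsStronglyConvexSmooth μ l (f i))
    (hz : ∀ z, globalCost f zstar ≤ globalCost f z) :
    mean (fun i => gradient (f i) zstar) = 0 := by
  have hn' : (0 : ℝ) < n := by exact_mod_cast hn
  set a := mean (fun i => gradient (f i) zstar) with ha
  set w := zstar - (1 / l) • a with hw
  have e : w - zstar = -((1 / l) • a) := by rw [hw]; abel
  have e' : ‖zstar - w‖ ^ 2 = (1 / l) ^ 2 * ‖a‖ ^ 2 := by
    rw [norm_sub_rev, e, norm_neg, norm_smul, mul_pow, Real.norm_eq_abs, sq_abs]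
  have h1 : ∑ i, f i w ≤ ∑ i, (f i zstar + l / 2 * ((1 / l) ^ 2 * ‖a‖ ^ 2)
      - (1 / l) * inner ℝ (gradient (f i) zstar) a) := by
    refine Finset.sum_le_sum fun i _ => ?_
    have := (hf i).upper zstar w
    rw [e, e', inner_neg_right, inner_smul_right] at this
    linarith
  have h2 : ∑ i, inner ℝ (gradient (f i) zstar) a = n * ‖a‖ ^ 2 := by
    rw [← sum_inner, ← real_inner_self_eq_norm_sq a]
    have : ∑ i, gradient (f i) zstar = (n : ℝ) • a := by
      rw [ha, mean, smul_smul, mul_one_div_cancel hn'.ne', one_smul]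
    rw [this, real_inner_smul_left]
  rw [Finset.sum_sub_distrib, Finset.sum_add_distrib,
    ← Finset.mul_sum Finset.univ (fun i => inner ℝ (gradient (f i) zstar) a), h2] at h1
  simp only [Finset.sum_const, Finset.card_univ, Fintype.card_fin, nsmul_eq_mul] at h1
  have h3 : ∑ i, f i zstar ≤ ∑ i, f i w := by
    have := hz w
    simp only [globalCost] at this
    exact le_of_mul_le_mul_left this (by positivity)
  have h4 : (n : ℝ) * (l / 2 * ((1 / l) ^ 2 * ‖a‖ ^ 2)) - 1 / l * (n * ‖a‖ ^ 2) =
      -(n / (2 * l)) * ‖a‖ ^ 2 := by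
    field_simp
    ring
  have h5 : n / (2 * l) * ‖a‖ ^ 2 ≤ 0 := by linarith
  have h6 : ‖a‖ ^ 2 ≤ 0 := by
    by_contra! h
    have : 0 < n / (2 * l) * ‖a‖ ^ 2 := by positivity
    linarith
  exact norm_eq_zero.1 (pow_eq_zero_iff two_ne_zero |>.1 (le_antisymm h6 (sq_nonneg _)))

theorem norm_sub_smul_mean_gradient_sq_le (hn : 0 < n) (hμ : 0 < μ) (hl : 0 < l)
    (hf : ∀ i, IsStronglyConvexSmooth μ l (f i))
    (h0 : mean (fun i => gradient (f i) zstar) = 0) (x : EuclideanSpace ℝ (Fin p)) {a : ℝ}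
    (ha : 0 ≤ a) :
    ‖x - zstar - a • mean (fun i => gradient (f i) x)‖ ^ 2 ≤
      (1 - 2 * μ * a + 4 * n * l ^ 2 * a ^ 2) * ‖x - zstar‖ ^ 2 := by
  have hn' : (0 : ℝ) < n := by exact_mod_cast hn
  set d := x - zstar
  set G := mean (fun i => gradient (f i) x)
  have hG' : G = mean (fun i => gradient (f i) x - gradient (f i) zstar) := by
    rw [mean_sub, h0, sub_zero]
  have h1 : ‖G‖ ^ 2 ≤ 4 * n * l ^ 2 * ‖d‖ ^ 2 := by
    rw [hG']
    refine (norm_mean_sq_le _).trans ?_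
    calc ∑ i, ‖gradient (f i) x - gradient (f i) zstar‖ ^ 2
        ≤ ∑ _i : Fin n, (2 * l * ‖d‖) ^ 2 := Finset.sum_le_sum fun i _ => by
          gcongr
          exact (hf i).norm_gradient_sub_le hμ hl _ _
      _ = _ := by
          simp
          ring
  have h2 : μ * ‖d‖ ^ 2 ≤ inner ℝ d G := by
    rw [hG', mean, inner_smul_right, inner_sum, one_div_mul_eq_div, le_div_iff₀ hn']
    calc μ * ‖d‖ ^ 2 * n = ∑ _i : Fin n, μ * ‖d‖ ^ 2 := by simp [mul_comm]
      _ ≤ _ := Finset.sum_le_sum fun i _ => (hf i).mul_norm_sq_le_inner _ _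
  rw [norm_sub_sq_real, inner_smul_right, norm_smul, mul_pow, Real.norm_eq_abs, sq_abs]
  nlinarith [mul_le_mul_of_nonneg_left h1 (sq_nonneg a), mul_le_mul_of_nonneg_left h2 ha]

/-- A step along the average of gradients taken at different points `z i`: the contraction factor
`1 - 2 μ a` of the exact gradient step is weakened by `τ a`, where `τ` may be as small as desired,
to pay for the distances between `z i` and `x`. -/
theorem norm_sub_smul_mean_gradient_sq_le_of_perturbed (hn : 0 < n) (hμ : 0 < μ) (hl : 0 < l)
    (hf : ∀ i, IsStronglyConvexSmooth μ l (f i))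
    (h0 : mean (fun i => gradient (f i) zstar) = 0) {τ a₀ : ℝ} (hτ : 0 < τ) :
    ∃ c, 0 < c ∧ ∀ (a : ℝ) (x : EuclideanSpace ℝ (Fin p)) (z : Fin n → EuclideanSpace ℝ (Fin p)),
      0 < a → a ≤ a₀ →
      ‖x - zstar - a • mean (fun i => gradient (f i) (z i))‖ ^ 2 ≤
        (1 - (2 * μ - τ) * a + c * a ^ 2) * ‖x - zstar‖ ^ 2 + c * a * ∑ i, ‖z i - x‖ ^ 2 := by
  have hn' : (0 : ℝ) < n := by exact_mod_cast hn
  refine ⟨4 * n * l ^ 2 * (1 + τ * |a₀|) + 4 * l ^ 2 * (|a₀| + 1 / τ), by positivity,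
    fun a x z ha ha₀ => ?_⟩
  have ha₁ : a ≤ |a₀| := ha₀.trans (le_abs_self a₀)
  have e : x - zstar - a • mean (fun i => gradient (f i) (z i)) =
      (x - zstar - a • mean (fun i => gradient (f i) x)) +
        a • mean (fun i => gradient (f i) x - gradient (f i) (z i)) := by
    rw [mean_sub, smul_sub]
    abel
  have h1 := norm_sub_smul_mean_gradient_sq_le hn hμ hl hf h0 x ha.le
  have h2 : ‖mean (fun i => gradient (f i) x - gradient (f i) (z i))‖ ^ 2 ≤
      4 * l ^ 2 * ∑ i, ‖z i - x‖ ^ 2 := by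
    refine (norm_mean_sq_le _).trans ?_
    rw [Finset.mul_sum]
    refine Finset.sum_le_sum fun i _ => ?_
    calc ‖gradient (f i) x - gradient (f i) (z i)‖ ^ 2 ≤ (2 * l * ‖x - z i‖) ^ 2 := by
          gcongr
          exact (hf i).norm_gradient_sub_le hμ hl _ _
      _ = _ := by
          rw [norm_sub_rev]
          ring
  have h3 := norm_add_sq_le_of_pos (x - zstar - a • mean (fun i => gradient (f i) x))
    (a • mean (fun i => gradient (f i) x - gradient (f i) (z i))) (mul_pos hτ ha)
  rw [← e, norm_smul a, mul_pow, Real.norm_eq_abs, sq_abs] at h3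
  have hS : 0 ≤ ∑ i, ‖z i - x‖ ^ 2 := Finset.sum_nonneg fun i _ => sq_nonneg _
  refine h3.trans ?_
  calc (1 + τ * a) * ‖x - zstar - a • mean (fun i => gradient (f i) x)‖ ^ 2 +
        (1 + 1 / (τ * a)) *
          (a ^ 2 * ‖mean (fun i => gradient (f i) x - gradient (f i) (z i))‖ ^ 2)
      ≤ (1 + τ * a) * ((1 - 2 * μ * a + 4 * n * l ^ 2 * a ^ 2) * ‖x - zstar‖ ^ 2) +
        (1 + 1 / (τ * a)) * (a ^ 2 * (4 * l ^ 2 * ∑ i, ‖z i - x‖ ^ 2)) := by gcongr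
    _ = (1 - (2 * μ - τ) * a - 2 * μ * τ * a ^ 2 + 4 * n * l ^ 2 * (1 + τ * a) * a ^ 2) *
          ‖x - zstar‖ ^ 2 + 4 * l ^ 2 * (a + 1 / τ) * a * ∑ i, ‖z i - x‖ ^ 2 := by
        field_simp
        ring
    _ ≤ _ := by
        have p1 : 0 ≤ 2 * μ * τ * a ^ 2 := by positivity
        have p2 : 4 * n * l ^ 2 * (1 + τ * a) ≤
            4 * n * l ^ 2 * (1 + τ * |a₀|) + 4 * l ^ 2 * (|a₀| + 1 / τ) := by
          have : 4 * n * l ^ 2 * (1 + τ * a) ≤ 4 * n * l ^ 2 * (1 + τ * |a₀|) := by gcongr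
          have : 0 ≤ 4 * l ^ 2 * (|a₀| + 1 / τ) := by positivity
          linarith
        have p3 : 4 * l ^ 2 * (a + 1 / τ) ≤
            4 * n * l ^ 2 * (1 + τ * |a₀|) + 4 * l ^ 2 * (|a₀| + 1 / τ) := by
          have : 4 * l ^ 2 * (a + 1 / τ) ≤ 4 * l ^ 2 * (|a₀| + 1 / τ) := by gcongr
          have : 0 ≤ 4 * n * l ^ 2 * (1 + τ * |a₀|) := by positivity
          linarith
        have p4 := mul_le_mul_of_nonneg_right p2 (sq_nonneg a)
        refine add_le_add (mul_le_mul_of_nonneg_right (by linarith) (sq_nonneg _)) ?_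
        gcongr

end Gradient

/-! ### The iterates along one sequence of sampled gradients -/

section Iterates

variable {n p : ℕ} {G : Digraph (Fin n)} {B : Matrix (Fin n) (Fin n) ℝ} {v : Fin n → ℝ}

/-- The deviation `w_k - g_k` of the gradient tracker from the current sampled gradients. Unlike
`w_k`, it only depends on the gradients sampled before iteration `k`. -/
noncomputable def trackDev (B : Matrix (Fin n) (Fin n) ℝ)
    (g : ℕ → Fin n → EuclideanSpace ℝ (Fin p)) (k : ℕ) (i : Fin n) : EuclideanSpace ℝ (Fin p) :=
  wIter B g k i - g k i

theorem wIter_eq_trackDev_add (g : ℕ → Fin n → EuclideanSpace ℝ (Fin p)) (k : ℕ) (i : Fin n) :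
    wIter B g k i = trackDev B g k i + g k i := by
  simp [trackDev]

theorem trackDev_zero (g : ℕ → Fin n → EuclideanSpace ℝ (Fin p)) (i : Fin n) :
    trackDev B g 0 i = 0 := by
  simp [trackDev, wIter]

theorem trackDev_succ (g : ℕ → Fin n → EuclideanSpace ℝ (Fin p)) (k : ℕ) (i : Fin n) :
    trackDev B g (k + 1) i = ∑ j, B i j • (trackDev B g k j + g k j) - g k i := by
  simp only [← wIter_eq_trackDev_add]
  simp only [trackDev, wIter]
  abel

theorem xIter_succ (α : ℕ → ℝ) (x₀ : Fin n → EuclideanSpace ℝ (Fin p))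
    (g : ℕ → Fin n → EuclideanSpace ℝ (Fin p)) (k : ℕ) (i : Fin n) :
    xIter B α x₀ g (k + 1) i =
      ∑ j, B i j • xIter B α x₀ g k j - α k • (trackDev B g k i + g k i) := by
  rw [← wIter_eq_trackDev_add]
  rfl

theorem IsWeightMatrix.sum_blockMul (hB : IsWeightMatrix G B)
    (x : Fin n → EuclideanSpace ℝ (Fin p)) : ∑ i, ∑ j, B i j • x j = ∑ i, x i := by
  rw [Finset.sum_comm]
  simp only [← Finset.sum_smul, hB.col_sum, one_smul]

theorem sum_trackDev (hB : IsWeightMatrix G B) (g : ℕ → Fin n → EuclideanSpace ℝ (Fin p))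
    (k : ℕ) : ∑ i, trackDev B g k i = 0 := by
  induction k with
  | zero => simp [trackDev_zero]
  | succ k ih =>
    simp only [trackDev_succ, Finset.sum_sub_distrib]
    rw [hB.sum_blockMul, Finset.sum_add_distrib, ih]
    simp

/-- The average iterate moves along the average of the current sampled gradients. -/
theorem mean_xIter_succ (hB : IsWeightMatrix G B) (α : ℕ → ℝ)
    (x₀ : Fin n → EuclideanSpace ℝ (Fin p)) (g : ℕ → Fin n → EuclideanSpace ℝ (Fin p)) (k : ℕ) :
    mean (xIter B α x₀ g (k + 1)) = mean (xIter B α x₀ g k) - α k • mean (g k) := by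
  simp only [mean, xIter_succ, Finset.sum_sub_distrib, ← Finset.smul_sum]
  rw [hB.sum_blockMul, Finset.sum_add_distrib, sum_trackDev hB, zero_add, smul_sub,
    smul_comm (α k)]

theorem weightedAvg_eq (v : Fin n → ℝ) (x : Fin n → EuclideanSpace ℝ (Fin p)) (i : Fin n) :
    weightedAvg v x i = v i • ∑ j, x j := by
  simp [weightedAvg, limitMatrix, Finset.smul_sum]

/-- One step of the agreement error: the disagreement is multiplied by `B - B^∞`, and the
tracker enters through `I - B^∞`. -/
theorem xIter_succ_sub_weightedAvg (hB : IsWeightMatrix G B) (hv : IsPerronVector B v)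
    (α : ℕ → ℝ) (x₀ : Fin n → EuclideanSpace ℝ (Fin p))
    (g : ℕ → Fin n → EuclideanSpace ℝ (Fin p)) (k : ℕ) (i : Fin n) :
    xIter B α x₀ g (k + 1) i - weightedAvg v (xIter B α x₀ g (k + 1)) i =
      blockMul (B - limitMatrix v)
        (fun j => xIter B α x₀ g k j - weightedAvg v (xIter B α x₀ g k) j) i +
      (-α k) • blockMul (1 - limitMatrix v) (fun j => trackDev B g k j + g k j) i := by
  simp only [weightedAvg_eq, xIter_succ, Finset.sum_sub_distrib, ← Finset.smul_sum]
  rw [hB.sum_blockMul]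
  set x := xIter B α x₀ g k
  set w := fun j => trackDev B g k j + g k j
  have e1 : blockMul (B - limitMatrix v) (fun j => x j - v j • ∑ j, x j) i =
      ∑ j, B i j • x j - v i • ∑ j, x j := by
    simp only [blockMul, Matrix.sub_apply, limitMatrix, Matrix.of_apply, sub_smul, smul_sub,
      Finset.sum_sub_distrib, ← Finset.smul_sum, smul_smul, ← Finset.sum_smul, hv.sum_mul,
      sub_mul, ← Finset.mul_sum, hv.sum_eq_one, mul_one]
    abel
  have e2 : blockMul (1 - limitMatrix v) w i = w i - v i • ∑ j, w j := by
    simp [blockMul, limitMatrix, sub_smul, Finset.sum_sub_distrib, ← Finset.smul_sum,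
      Matrix.one_apply, ite_smul]
  rw [e1, e2, neg_smul, smul_sub, smul_sub, smul_comm (v i) (α k)]
  abel

theorem trackDev_succ_eq_blockMul (hB : IsWeightMatrix G B)
    (g : ℕ → Fin n → EuclideanSpace ℝ (Fin p)) (k : ℕ) (i : Fin n) :
    trackDev B g (k + 1) i =
      blockMul (B - limitMatrix v) (trackDev B g k) i + blockMul (B - 1) (g k) i := by
  rw [trackDev_succ]
  have e1 : blockMul (B - limitMatrix v) (trackDev B g k) i = ∑ j, B i j • trackDev B g k j := by
    simp only [blockMul, Matrix.sub_apply, limitMatrix, Matrix.of_apply, sub_smul,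
      Finset.sum_sub_distrib, ← Finset.smul_sum, sum_trackDev hB, smul_zero, sub_zero]
  have e2 : blockMul (B - 1) (g k) i = ∑ j, B i j • g k j - g k i := by
    simp [blockMul, sub_smul, Finset.sum_sub_distrib, Matrix.one_apply, ite_smul]
  rw [e1, e2]
  simp only [smul_add, Finset.sum_add_distrib]
  abel

/-- The agreement error and the tracking deviation contract at a common rate `r < 1`. -/
theorem exists_contraction (hG : IsStronglyConnectedNetwork G) (hB : IsWeightMatrix G B)
    (hv : IsPerronVector B v) : ∃ r c : ℝ, 0 ≤ r ∧ r < 1 ∧ 0 < c ∧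
      ∀ (α : ℕ → ℝ) (x₀ : Fin n → EuclideanSpace ℝ (Fin p))
        (g : ℕ → Fin n → EuclideanSpace ℝ (Fin p)) (k : ℕ),
        agreementError v (xIter B α x₀ g (k + 1)) ≤ r * agreementError v (xIter B α x₀ g k)
          + c * α k ^ 2 * (piNormSq v (trackDev B g k) + piNormSq v (g k)) ∧
        piNormSq v (trackDev B g (k + 1)) ≤
          r * piNormSq v (trackDev B g k) + c * piNormSq v (g k) := by
  have hs0 := sigmaB_nonneg B v
  have hs1 := sigmaB_lt_one hG hB hv
  obtain ⟨q, hq⟩ : ∃ q, q = sigmaB B v ^ 2 := ⟨_, rfl⟩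
  have hq0 : 0 ≤ q := hq ▸ sq_nonneg _
  have hq1 : q < 1 := by nlinarith
  obtain ⟨t, ht⟩ : ∃ t, t = (1 - q) / 2 := ⟨_, rfl⟩
  have ht0 : 0 < t := by rw [ht]; linarith
  obtain ⟨K₁, hK₁⟩ : ∃ K, K = piMatrixNorm v (1 - limitMatrix v) := ⟨_, rfl⟩
  obtain ⟨K₂, hK₂⟩ : ∃ K, K = piMatrixNorm v (B - 1) := ⟨_, rfl⟩
  obtain ⟨c₁, hc₁⟩ : ∃ c, c = (1 + 1 / t) * (K₁ ^ 2 * 2) := ⟨_, rfl⟩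
  obtain ⟨c₂, hc₂⟩ : ∃ c, c = (1 + 1 / t) * K₂ ^ 2 := ⟨_, rfl⟩
  have hc₁0 : 0 ≤ c₁ := by rw [hc₁]; positivity
  have hc₂0 : 0 ≤ c₂ := by rw [hc₂]; positivity
  refine ⟨(1 + t) * q, c₁ + c₂ + 1, by positivity, by nlinarith, by positivity,
    fun α x₀ g k => ⟨?_, ?_⟩⟩
  · have hU := piNormSq_nonneg hv.pos (trackDev B g k)
    have hH := piNormSq_nonneg hv.pos (g k)
    rw [agreementError, funext fun i => xIter_succ_sub_weightedAvg hB hv α x₀ g k i]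
    refine (piNormSq_add_le hv.pos _ _ ht0).trans ?_
    rw [piNormSq_smul v (-α k), neg_sq]
    have h2 : piNormSq v (blockMul (B - limitMatrix v)
        (fun j => xIter B α x₀ g k j - weightedAvg v (xIter B α x₀ g k) j)) ≤
        q * agreementError v (xIter B α x₀ g k) := hq ▸ piNormSq_blockMul_le hv.pos _ _
    have h3 := piNormSq_blockMul_le hv.pos (1 - limitMatrix v)
      (fun j => trackDev B g k j + g k j)
    rw [← hK₁] at h3
    have h4 : piNormSq v (fun j => trackDev B g k j + g k j) ≤
        2 * (piNormSq v (trackDev B g k) + piNormSq v (g k)) := by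
      have := piNormSq_add_le hv.pos (trackDev B g k) (g k) one_pos
      norm_num at this
      linarith
    calc _ ≤ (1 + t) * (q * agreementError v (xIter B α x₀ g k)) + (1 + 1 / t) * (α k ^ 2 *
          (K₁ ^ 2 *
            (2 * (piNormSq v (trackDev B g k) + piNormSq v (g k))))) := by
          refine add_le_add (mul_le_mul_of_nonneg_left h2 (by positivity))
            (mul_le_mul_of_nonneg_left (mul_le_mul_of_nonneg_left (h3.trans ?_) (sq_nonneg _))
              (by positivity))
          exact mul_le_mul_of_nonneg_left h4 (sq_nonneg _)
      _ = (1 + t) * q * agreementError v (xIter B α x₀ g k) +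
          c₁ * α k ^ 2 * (piNormSq v (trackDev B g k) + piNormSq v (g k)) := by
          rw [hc₁]
          ring
      _ ≤ _ := by
          gcongr
          linarith
  · have hH := piNormSq_nonneg hv.pos (g k)
    rw [funext fun i => trackDev_succ_eq_blockMul (v := v) hB g k i]
    refine (piNormSq_add_le hv.pos _ _ ht0).trans ?_
    have h2 : piNormSq v (blockMul (B - limitMatrix v) (trackDev B g k)) ≤
        q * piNormSq v (trackDev B g k) := hq ▸ piNormSq_blockMul_le hv.pos _ _
    have h3 := piNormSq_blockMul_le hv.pos (B - 1) (g k)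
    rw [← hK₂] at h3
    calc _ ≤ (1 + t) * (q * piNormSq v (trackDev B g k)) +
          (1 + 1 / t) * (K₂ ^ 2 * piNormSq v (g k)) := by
          gcongr
      _ = (1 + t) * q * piNormSq v (trackDev B g k) + c₂ * piNormSq v (g k) := by
          rw [hc₂]
          ring
      _ ≤ _ := by
          gcongr
          linarith

theorem inv_smul_sub_mean_eq (hn : 0 < n) (v : Fin n → ℝ) (x : Fin n → EuclideanSpace ℝ (Fin p))
    (a : ℝ) (i : Fin n) :
    a⁻¹ • x i - mean x = a⁻¹ • (x i - weightedAvg v x i) + (n * v i / a - 1) • mean x := by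
  have hn' : (n : ℝ) ≠ 0 := by exact_mod_cast hn.ne'
  have h1 : weightedAvg v x i = (n * v i) • mean x := by
    rw [weightedAvg_eq, mean, smul_smul]
    congr 1
    field_simp
  rw [h1, smul_sub, smul_smul, sub_smul, one_smul, div_eq_inv_mul]
  abel

/-- The distance of the corrected iterates `z_k` to the average `x̄_k`, through the agreement
error and the error of the eigenvector estimates. -/
theorem exists_sum_norm_zIter_sub_mean_sq_le (hG : IsStronglyConnectedNetwork G)
    (hB : IsWeightMatrix G B) (hv : IsPerronVector B v) {θ m : ℝ} (hθ : 0 < θ) (hm : 0 < m)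
    (zstar : EuclideanSpace ℝ (Fin p)) : ∃ c, 0 < c ∧
      ∀ (x₀ : Fin n → EuclideanSpace ℝ (Fin p)) (g : ℕ → Fin n → EuclideanSpace ℝ (Fin p)) (k : ℕ),
        ∑ i, ‖zIter B (decayingStep θ m) x₀ g k i - mean (xIter B (decayingStep θ m) x₀ g k)‖ ^ 2 ≤
          c * (agreementError v (xIter B (decayingStep θ m) x₀ g k) + decayingStep θ m k ^ 2 *
            (optimalityGap zstar (xIter B (decayingStep θ m) x₀ g k) + 1)) := by
  have hn := hv.card_pos
  have hn' : (0 : ℝ) < n := by exact_mod_cast hn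
  obtain ⟨R, hR0, hR⟩ := exists_div_yIter_sub_one_sq_le hG hB hv hm
  set V := ∑ i, (v i)⁻¹
  have hV0 : 0 ≤ V := Finset.sum_nonneg fun i _ => inv_nonneg.2 (hv.pos i).le
  set c₂ := 4 * n * (R / θ ^ 2) * (1 + ‖zstar‖ ^ 2) with hc₂
  refine ⟨2 * V + c₂ + 1, by positivity, fun x₀ g k => ?_⟩
  set α := decayingStep θ m
  set x := xIter B α x₀ g k
  have hα : R / (m + k) ^ 2 = R / θ ^ 2 * α k ^ 2 := by
    have : 0 < m + (k : ℝ) := by positivity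
    simp only [α, decayingStep]
    field_simp
  have hX0 : 0 ≤ agreementError v x := piNormSq_nonneg hv.pos _
  have hD0 : 0 ≤ optimalityGap zstar x := sq_nonneg _
  have h1 : ∀ i, ‖zIter B α x₀ g k i - mean x‖ ^ 2 ≤
      2 * V * (‖x i - weightedAvg v x i‖ ^ 2 / v i) + 2 * (R / θ ^ 2 * α k ^ 2) * ‖mean x‖ ^ 2 := by
    intro i
    have hv0 := hv.pos i
    have hy := le_yIter hB hv k i
    have hy0 := hv0.trans_le hy
    have hvV : (v i)⁻¹ ≤ V := Finset.single_le_sum (f := fun i => (v i)⁻¹)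
      (fun j _ => inv_nonneg.2 (hv.pos j).le) (Finset.mem_univ i)
    rw [zIter, inv_smul_sub_mean_eq hn v]
    refine (norm_add_sq_le_two _ _).trans ?_
    rw [norm_smul, norm_smul, mul_pow, mul_pow, Real.norm_eq_abs, Real.norm_eq_abs, sq_abs, sq_abs,
      mul_assoc 2 V, mul_assoc 2 (R / θ ^ 2 * α k ^ 2)]
    refine add_le_add (mul_le_mul_of_nonneg_left ?_ zero_le_two)
      (mul_le_mul_of_nonneg_left (mul_le_mul_of_nonneg_right ?_ (sq_nonneg _)) zero_le_two)
    · calc (yIter B k i)⁻¹ ^ 2 * ‖x i - weightedAvg v x i‖ ^ 2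
          ≤ (v i)⁻¹ ^ 2 * ‖x i - weightedAvg v x i‖ ^ 2 := by gcongr
        _ = (v i)⁻¹ * (‖x i - weightedAvg v x i‖ ^ 2 / v i) := by
            field_simp
        _ ≤ V * (‖x i - weightedAvg v x i‖ ^ 2 / v i) := by gcongr
    · rw [← hα]
      exact hR k i
  have h2 : ‖mean x‖ ^ 2 ≤ 2 * (1 + ‖zstar‖ ^ 2) * (optimalityGap zstar x + 1) := by
    have := norm_add_sq_le_two (mean x - zstar) zstar
    rw [sub_add_cancel] at this
    simp only [optimalityGap] at hD0 ⊢
    nlinarith [mul_nonneg hD0 (sq_nonneg ‖zstar‖)]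
  calc ∑ i, ‖zIter B α x₀ g k i - mean x‖ ^ 2
      ≤ ∑ i, (2 * V * (‖x i - weightedAvg v x i‖ ^ 2 / v i) +
          2 * (R / θ ^ 2 * α k ^ 2) * ‖mean x‖ ^ 2) := Finset.sum_le_sum fun i _ => h1 i
    _ = 2 * V * agreementError v x + n * (2 * (R / θ ^ 2 * α k ^ 2) * ‖mean x‖ ^ 2) := by
        rw [Finset.sum_add_distrib, ← Finset.mul_sum]
        simp [agreementError, piNormSq]
    _ ≤ 2 * V * agreementError v x + n * (2 * (R / θ ^ 2 * α k ^ 2) *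
          (2 * (1 + ‖zstar‖ ^ 2) * (optimalityGap zstar x + 1))) := by gcongr
    _ = 2 * V * agreementError v x + c₂ * (α k ^ 2 * (optimalityGap zstar x + 1)) := by
        rw [hc₂]
        ring
    _ ≤ _ := by
        have p1 : 0 ≤ c₂ := by positivity
        have p2 : 0 ≤ α k ^ 2 * (optimalityGap zstar x + 1) := by positivity
        nlinarith [mul_nonneg p1 hX0, mul_nonneg hV0 p2]

end Iterates

/-! ### Stochastic gradients -/

theorem stronglyMeasurable_sum_smul {n p : ℕ} {Ω : Type*} {m' : MeasurableSpace Ω}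
    {x : Fin n → Ω → EuclideanSpace ℝ (Fin p)} (a : Fin n → ℝ)
    (hx : ∀ i, StronglyMeasurable[m'] (x i)) :
    StronglyMeasurable[m'] fun ω => ∑ i, a i • x i ω :=
  Finset.stronglyMeasurable_fun_sum Finset.univ fun i _ => (hx i).fun_const_smul (a i)

theorem memLp_smul {p : ℕ} {Ω : Type*} {mΩ : MeasurableSpace Ω} {P : Measure Ω}
    {x : Ω → EuclideanSpace ℝ (Fin p)} (hx : MemLp x 2 P) (a : ℝ) :
    MemLp (fun ω => a • x ω) 2 P :=
  hx.const_smul a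

theorem integrable_inner_of_memLp {p : ℕ} {Ω : Type*} {mΩ : MeasurableSpace Ω} {P : Measure Ω}
    {a e : Ω → EuclideanSpace ℝ (Fin p)} (ha : MemLp a 2 P)
    (he : MemLp e 2 P) : Integrable (fun ω => inner ℝ (a ω) (e ω)) P := by
  refine Integrable.mono' (((memLp_two_iff_integrable_sq_norm ha.1).1 ha).add
    ((memLp_two_iff_integrable_sq_norm he.1).1 he)) (ha.1.inner he.1) (ae_of_all _ fun ω => ?_)
  have := norm_inner_le_norm (𝕜 := ℝ) (a ω) (e ω)
  simp only [Pi.add_apply]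
  nlinarith [sq_nonneg (‖a ω‖ - ‖e ω‖), sq_nonneg ‖a ω‖, sq_nonneg ‖e ω‖]

theorem integral_inner_eq_zero_of_condExp_eq_zero {p : ℕ} {Ω : Type*}
    {m' mΩ : MeasurableSpace Ω} {P : Measure Ω} [IsFiniteMeasure P] (hm' : m' ≤ mΩ)
    {a e : Ω → EuclideanSpace ℝ (Fin p)} (ha : StronglyMeasurable[m'] a)
    (ha2 : MemLp a 2 P) (he2 : MemLp e 2 P) (he : P[e | m'] =ᵐ[P] 0) :
    ∫ ω, inner ℝ (a ω) (e ω) ∂P = 0 := by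
  have h1 : Integrable (fun ω => inner ℝ (a ω) (e ω)) P := integrable_inner_of_memLp ha2 he2
  have h2 : P[fun ω => inner ℝ (a ω) (e ω) | m'] =ᵐ[P] fun ω => inner ℝ (a ω) (P[e | m'] ω) :=
    condExp_bilin_of_stronglyMeasurable_left (innerSL ℝ) ha h1 (he2.integrable one_le_two)
  rw [← integral_condExp hm', integral_congr_ae h2]
  refine integral_eq_zero_of_ae ?_
  filter_upwards [he] with ω hω
  simp [hω]

section Stochastic

variable {n p : ℕ} {G : Digraph (Fin n)} {B : Matrix (Fin n) (Fin n) ℝ} {v : Fin n → ℝ}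
  {Ω : Type*} [mΩ : MeasurableSpace Ω] {P : Measure Ω} {ℱ : Filtration ℕ mΩ}
  {f : Fin n → EuclideanSpace ℝ (Fin p) → ℝ} {μ l σ : ℝ}
  {α : ℕ → ℝ} {x₀ : Fin n → EuclideanSpace ℝ (Fin p)}
  {z g : ℕ → Fin n → Ω → EuclideanSpace ℝ (Fin p)}

theorem memLp_mean {x : Fin n → Ω → EuclideanSpace ℝ (Fin p)} (hx : ∀ i, MemLp (x i) 2 P) :
    MemLp (fun ω => mean fun i => x i ω) 2 P :=
  memLp_smul (memLp_finsetSum Finset.univ fun i _ => hx i) _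

theorem memLp_sum_smul {x : Fin n → Ω → EuclideanSpace ℝ (Fin p)} (a : Fin n → ℝ)
    (hx : ∀ i, MemLp (x i) 2 P) : MemLp (fun ω => ∑ i, a i • x i ω) 2 P :=
  memLp_finsetSum Finset.univ fun i _ => memLp_smul (hx i) (a i)

theorem integrable_norm_sq {x : Ω → EuclideanSpace ℝ (Fin p)} (hx : MemLp x 2 P) :
    Integrable (fun ω => ‖x ω‖ ^ 2) P :=
  (memLp_two_iff_integrable_sq_norm hx.1).1 hx

theorem integrable_piNormSq (v : Fin n → ℝ) {x : Fin n → Ω → EuclideanSpace ℝ (Fin p)}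
    (hx : ∀ i, MemLp (x i) 2 P) : Integrable (fun ω => piNormSq v fun i => x i ω) P :=
  integrable_finsetSum _ fun i _ => (integrable_norm_sq (hx i)).div_const _

theorem IsStronglyConvexSmooth.continuous_gradient (hμ : 0 < μ) (hl : 0 < l)
    {f : EuclideanSpace ℝ (Fin p) → ℝ} (hf : IsStronglyConvexSmooth μ l f) :
    Continuous (gradient f) := by
  refine (LipschitzWith.of_dist_le_mul (K := ⟨2 * l, by positivity⟩) fun x y => ?_).continuous
  rw [dist_eq_norm, dist_eq_norm]
  exact hf.norm_gradient_sub_le hμ hl y x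

theorem IsStronglyConvexSmooth.memLp_gradient [IsFiniteMeasure P] (hμ : 0 < μ) (hl : 0 < l)
    {f : EuclideanSpace ℝ (Fin p) → ℝ} (hf : IsStronglyConvexSmooth μ l f)
    {x : Ω → EuclideanSpace ℝ (Fin p)} (hx : MemLp x 2 P) :
    MemLp (fun ω => gradient f (x ω)) 2 P := by
  have h1 : MemLp (fun ω => gradient f (x ω) - gradient f 0) 2 P := by
    refine MemLp.of_le (hx.const_smul (2 * l))
      (((hf.continuous_gradient hμ hl).comp_aestronglyMeasurable hx.1).sub
        aestronglyMeasurable_const) (ae_of_all _ fun ω => ?_)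
    have := hf.norm_gradient_sub_le hμ hl 0 (x ω)
    rwa [sub_zero, ← abs_of_pos (show 0 < 2 * l by positivity), ← Real.norm_eq_abs,
      ← norm_smul] at this
  refine (h1.add (memLp_const (gradient f 0))).ae_eq (ae_of_all _ fun ω => ?_)
  simp

/-- The iterates of step `k` are determined by the samples drawn before iteration `k`. -/
theorem IsStochasticOracle.stronglyMeasurable_iterates (hg : IsStochasticOracle P ℱ f σ z g)
    (B : Matrix (Fin n) (Fin n) ℝ) (α : ℕ → ℝ) (x₀ : Fin n → EuclideanSpace ℝ (Fin p)) (k : ℕ) :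
    (∀ i, StronglyMeasurable[ℱ k] fun ω => xIter B α x₀ (fun t j => g t j ω) k i) ∧
      ∀ i, StronglyMeasurable[ℱ k] fun ω => trackDev B (fun t j => g t j ω) k i := by
  induction k with
  | zero =>
    simp only [trackDev_zero]
    exact ⟨fun i => stronglyMeasurable_const, fun i => stronglyMeasurable_const⟩
  | succ k ih =>
    have hx := fun i => (ih.1 i).mono (ℱ.mono k.le_succ)
    have hu := fun i => (ih.2 i).mono (ℱ.mono k.le_succ)
    have hgk := hg.measurable k
    simp only [xIter_succ, trackDev_succ]
    exact ⟨fun i => (stronglyMeasurable_sum_smul (B i) hx).sub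
        (((hu i).add (hgk i)).fun_const_smul (α k)),
      fun i => (stronglyMeasurable_sum_smul (B i) fun j => (hu j).add (hgk j)).sub (hgk i)⟩

theorem IsStochasticOracle.memLp_sample [IsFiniteMeasure P] (hg : IsStochasticOracle P ℱ f σ z g)
    (hμ : 0 < μ) (hl : 0 < l) (hf : ∀ i, IsStronglyConvexSmooth μ l (f i)) {k : ℕ}
    (hz : ∀ i, MemLp (z k i) 2 P) (i : Fin n) :
    MemLp (fun ω => g k i ω - gradient (f i) (z k i ω)) 2 P ∧ MemLp (g k i) 2 P := by
  have h1 := (hf i).memLp_gradient hμ hl (hz i)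
  have h2 : AEStronglyMeasurable (g k i) P :=
    ((hg.measurable k i).mono (ℱ.le _)).aestronglyMeasurable
  have h3 : MemLp (fun ω => g k i ω - gradient (f i) (z k i ω)) 2 P :=
    (memLp_two_iff_integrable_sq_norm (h2.sub h1.1)).2 (hg.integrable_sq k i)
  refine ⟨h3, ?_⟩
  have := h3.add h1
  refine this.congr_norm h2 (ae_of_all _ fun ω => ?_)
  simp

/-- All iterates are square integrable, the gradients being Lipschitz continuous. -/
theorem IsStochasticOracle.memLp_iterates [IsFiniteMeasure P]
    (hg : IsStochasticOracle P ℱ f σ z g) (hμ : 0 < μ) (hl : 0 < l)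
    (hf : ∀ i, IsStronglyConvexSmooth μ l (f i))
    (hz : ∀ k i ω, z k i ω = zIter B α x₀ (fun t j => g t j ω) k i) (k : ℕ) :
    (∀ i, MemLp (fun ω => xIter B α x₀ (fun t j => g t j ω) k i) 2 P) ∧
      (∀ i, MemLp (fun ω => trackDev B (fun t j => g t j ω) k i) 2 P) ∧
      ∀ i, MemLp (z k i) 2 P := by
  have hzk : ∀ k, (∀ i, MemLp (fun ω => xIter B α x₀ (fun t j => g t j ω) k i) 2 P) →
      ∀ i, MemLp (z k i) 2 P := fun k h i => by
    rw [show z k i = fun ω => (yIter B k i)⁻¹ • xIter B α x₀ (fun t j => g t j ω) k i from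
      funext fun ω => hz k i ω]
    exact memLp_smul (h i) _
  induction k with
  | zero =>
    have h1 : ∀ i, MemLp (fun ω => xIter B α x₀ (fun t j => g t j ω) 0 i) 2 P :=
      fun i => memLp_const _
    refine ⟨h1, fun i => ?_, hzk 0 h1⟩
    simp only [trackDev_zero]
    exact memLp_const _
  | succ k ih =>
    obtain ⟨hx, hu, hzz⟩ := ih
    have hgk := fun i => (hg.memLp_sample hμ hl hf hzz i).2
    have h1 : ∀ i, MemLp (fun ω => xIter B α x₀ (fun t j => g t j ω) (k + 1) i) 2 P := by
      intro i
      simp only [xIter_succ]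
      exact (memLp_sum_smul _ hx).sub (memLp_smul ((hu i).add (hgk i)) _)
    refine ⟨h1, fun i => ?_, hzk _ h1⟩
    simp only [trackDev_succ]
    exact (memLp_sum_smul _ fun j => (hu j).add (hgk j)).sub (hgk i)

theorem IsStochasticOracle.condExp_noise [IsFiniteMeasure P] (hg : IsStochasticOracle P ℱ f σ z g)
    {k : ℕ} {i : Fin n} (hz : StronglyMeasurable[ℱ k] fun ω => gradient (f i) (z k i ω))
    (hz' : Integrable (fun ω => gradient (f i) (z k i ω)) P) :
    P[fun ω => g k i ω - gradient (f i) (z k i ω) | ℱ k] =ᵐ[P] 0 := by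
  refine (condExp_sub (hg.integrable k i) hz' (ℱ k)).trans ?_
  rw [condExp_of_stronglyMeasurable (ℱ.le k) hz hz']
  filter_upwards [hg.unbiased k i] with ω hω
  simp [hω]

theorem IsStochasticOracle.integral_norm_noise_sq_le [IsProbabilityMeasure P]
    (hg : IsStochasticOracle P ℱ f σ z g) (k : ℕ) (i : Fin n) :
    ∫ ω, ‖g k i ω - gradient (f i) (z k i ω)‖ ^ 2 ∂P ≤ σ ^ 2 := by
  rw [← integral_condExp (ℱ.le k)]
  refine (integral_mono_ae integrable_condExp (integrable_const _) (hg.variance_le k i)).trans ?_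
  simp

/-- Averaging conditionally uncorrelated noises divides their variance by the number of nodes. -/
theorem IsStochasticOracle.integral_norm_mean_noise_sq_le [IsProbabilityMeasure P] (hn : 0 < n)
    (hg : IsStochasticOracle P ℱ f σ z g) {k : ℕ}
    (he : ∀ i, MemLp (fun ω => g k i ω - gradient (f i) (z k i ω)) 2 P) :
    ∫ ω, ‖mean fun i => g k i ω - gradient (f i) (z k i ω)‖ ^ 2 ∂P ≤ σ ^ 2 / n := by
  have hn' : (0 : ℝ) < n := by exact_mod_cast hn
  set e : Fin n → Ω → EuclideanSpace ℝ (Fin p) := fun i ω => g k i ω - gradient (f i) (z k i ω)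
  have h1 : ∀ ω, ‖mean fun i => e i ω‖ ^ 2 =
      (1 / (n : ℝ)) ^ 2 * ∑ i, ∑ j, inner ℝ (e i ω) (e j ω) := by
    intro ω
    rw [mean, norm_smul, mul_pow, Real.norm_eq_abs, sq_abs, ← real_inner_self_eq_norm_sq,
      sum_inner]
    simp only [inner_sum]
  have hint : ∀ i j, Integrable (fun ω => inner ℝ (e i ω) (e j ω)) P :=
    fun i j => integrable_inner_of_memLp (he i) (he j)
  have h2 : ∀ i j, i ≠ j → ∫ ω, inner ℝ (e i ω) (e j ω) ∂P = 0 := by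
    intro i j hij
    rw [← integral_condExp (ℱ.le k), integral_congr_ae (hg.uncorrelated k i j hij)]
    simp
  calc ∫ ω, ‖mean fun i => e i ω‖ ^ 2 ∂P
      = (1 / (n : ℝ)) ^ 2 * ∑ i, ∑ j, ∫ ω, inner ℝ (e i ω) (e j ω) ∂P := by
        simp only [h1]
        rw [integral_const_mul, integral_finsetSum _ fun i _ =>
          integrable_finsetSum _ fun j _ => hint i j]
        congr 1
        exact Finset.sum_congr rfl fun i _ => integral_finsetSum _ fun j _ => hint i j
    _ = (1 / (n : ℝ)) ^ 2 * ∑ i, ∫ ω, ‖e i ω‖ ^ 2 ∂P := by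
        congr 1
        refine Finset.sum_congr rfl fun i _ => ?_
        rw [Finset.sum_eq_single i (fun j _ hj => h2 i j hj.symm) (by simp)]
        simp only [real_inner_self_eq_norm_sq]
    _ ≤ (1 / (n : ℝ)) ^ 2 * ∑ _i : Fin n, σ ^ 2 := by
        gcongr with i
        exact hg.integral_norm_noise_sq_le k i
    _ = σ ^ 2 / n := by
        simp
        field_simp

/-- For a predictable point `a`, a step along the averaged noise only adds its variance, because
the noise is conditionally centred. -/
theorem IsStochasticOracle.integral_norm_sub_smul_mean_noise_sq_le [IsProbabilityMeasure P]
    (hn : 0 < n) (hg : IsStochasticOracle P ℱ f σ z g) {k : ℕ}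
    (he : ∀ i, MemLp (fun ω => g k i ω - gradient (f i) (z k i ω)) 2 P)
    (hz : ∀ i, StronglyMeasurable[ℱ k] fun ω => gradient (f i) (z k i ω))
    (hz' : ∀ i, Integrable (fun ω => gradient (f i) (z k i ω)) P)
    {a : Ω → EuclideanSpace ℝ (Fin p)} (ha : StronglyMeasurable[ℱ k] a) (ha2 : MemLp a 2 P)
    (s : ℝ) :
    ∫ ω, ‖a ω - s • mean fun i => g k i ω - gradient (f i) (z k i ω)‖ ^ 2 ∂P ≤
      ∫ ω, ‖a ω‖ ^ 2 ∂P + s ^ 2 * (σ ^ 2 / n) := by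
  set e : Ω → EuclideanSpace ℝ (Fin p) :=
    fun ω => mean fun i => g k i ω - gradient (f i) (z k i ω) with hedef
  have he2 : MemLp e 2 P := memLp_mean he
  have h1 : ∫ ω, inner ℝ (a ω) (e ω) ∂P = 0 := by
    simp only [hedef, mean, inner_smul_right, inner_sum]
    rw [integral_const_mul, integral_finsetSum _ fun i _ => integrable_inner_of_memLp ha2 (he i)]
    rw [Finset.sum_eq_zero fun i _ => integral_inner_eq_zero_of_condExp_eq_zero (ℱ.le k) ha ha2
      (he i) (hg.condExp_noise (hz i) (hz' i)), mul_zero]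
  have h2 : ∀ ω, ‖a ω - s • e ω‖ ^ 2 =
      ‖a ω‖ ^ 2 - 2 * s * inner ℝ (a ω) (e ω) + s ^ 2 * ‖e ω‖ ^ 2 := by
    intro ω
    rw [norm_sub_sq_real, inner_smul_right, norm_smul, mul_pow, Real.norm_eq_abs, sq_abs]
    ring
  have i1 : Integrable (fun ω => 2 * s * inner ℝ (a ω) (e ω)) P :=
    (integrable_inner_of_memLp ha2 he2).const_mul _
  have i2 := integrable_norm_sq ha2
  have i4 : Integrable (fun ω => ‖a ω‖ ^ 2 - 2 * s * inner ℝ (a ω) (e ω)) P := i2.sub i1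
  have i3 : Integrable (fun ω => s ^ 2 * ‖e ω‖ ^ 2) P := (integrable_norm_sq he2).const_mul _
  change ∫ ω, ‖a ω - s • e ω‖ ^ 2 ∂P ≤ _
  simp only [h2]
  rw [integral_add i4 i3, integral_sub i2 i1, integral_const_mul, integral_const_mul, h1,
    mul_zero, sub_zero]
  gcongr
  exact hg.integral_norm_mean_noise_sq_le hn he

end Stochastic

/-! ### Recursions in expectation -/

section Rates

variable {n p : ℕ} {G : Digraph (Fin n)} {B : Matrix (Fin n) (Fin n) ℝ} {v : Fin n → ℝ}
  {f : Fin n → EuclideanSpace ℝ (Fin p) → ℝ} {μ l σ θ m : ℝ} {zstar : EuclideanSpace ℝ (Fin p)}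
  {x₀ : Fin n → EuclideanSpace ℝ (Fin p)}

theorem integral_le_of_le_affine {Ω : Type*} {mΩ : MeasurableSpace Ω} {P : Measure Ω}
    [IsProbabilityMeasure P] {F A₁ A₂ A₃ : Ω → ℝ} (hF : Integrable F P) (h₁ : Integrable A₁ P)
    (h₂ : Integrable A₂ P) (h₃ : Integrable A₃ P) {a₁ a₂ a₃ b : ℝ}
    (h : ∀ ω, F ω ≤ a₁ * A₁ ω + a₂ * A₂ ω + a₃ * A₃ ω + b) :
    ∫ ω, F ω ∂P ≤ a₁ * ∫ ω, A₁ ω ∂P + a₂ * ∫ ω, A₂ ω ∂P + a₃ * ∫ ω, A₃ ω ∂P + b := by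
  have i₁ := h₁.const_mul a₁
  have i₂ := h₂.const_mul a₂
  have i₃ := h₃.const_mul a₃
  have i₁₂ : Integrable (fun ω => a₁ * A₁ ω + a₂ * A₂ ω) P := i₁.add i₂
  have i₁₃ : Integrable (fun ω => a₁ * A₁ ω + a₂ * A₂ ω + a₃ * A₃ ω) P := i₁₂.add i₃
  refine (integral_mono hF (i₁₃.add (integrable_const b)) h).trans (le_of_eq ?_)
  have e : ∫ ω, (a₁ * A₁ ω + a₂ * A₂ ω + a₃ * A₃ ω + b) ∂P = _ :=
    integral_add i₁₃ (integrable_const b)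
  refine e.trans ?_
  rw [integral_add i₁₂ i₃, integral_add i₁ i₂, integral_const_mul, integral_const_mul,
    integral_const_mul]
  simp

theorem norm_sub_sq_le_two_mul_add (z x : EuclideanSpace ℝ (Fin p)) :
    ‖z - zstar‖ ^ 2 ≤ 2 * ‖z - x‖ ^ 2 + 2 * ‖x - zstar‖ ^ 2 := by
  have := norm_add_sq_le_two (z - x) (x - zstar)
  rwa [sub_add_sub_cancel] at this

/-- The size of the sampled gradients, through the distances of the query points `z i` to a common
point `x`, of `x` to the minimizer, and the noise. -/
theorem exists_piNormSq_sample_le (hv : ∀ i, 0 < v i) (hμ : 0 < μ) (hl : 0 < l)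
    (hf : ∀ i, IsStronglyConvexSmooth μ l (f i)) (zstar : EuclideanSpace ℝ (Fin p)) :
    ∃ c, 0 < c ∧ ∀ (x : EuclideanSpace ℝ (Fin p)) (z g : Fin n → EuclideanSpace ℝ (Fin p)),
      piNormSq v g ≤ c * (1 + ‖x - zstar‖ ^ 2 + ∑ i, ‖z i - x‖ ^ 2 +
        ∑ i, ‖g i - gradient (f i) (z i)‖ ^ 2) := by
  set V := ∑ i, (v i)⁻¹
  have hV0 : 0 ≤ V := Finset.sum_nonneg fun i _ => inv_nonneg.2 (hv i).le
  set S := ∑ i, ‖gradient (f i) zstar‖ ^ 2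
  have hS0 : 0 ≤ S := Finset.sum_nonneg fun i _ => sq_nonneg _
  refine ⟨V * (4 * S + 32 * l ^ 2 * n + 32 * l ^ 2 + 2) + 1, by positivity, fun x z g => ?_⟩
  set N := ∑ i, ‖g i - gradient (f i) (z i)‖ ^ 2
  set Z := ∑ i, ‖z i - x‖ ^ 2
  set d := ‖x - zstar‖ ^ 2
  have hN0 : 0 ≤ N := Finset.sum_nonneg fun i _ => sq_nonneg _
  have hZ0 : 0 ≤ Z := Finset.sum_nonneg fun i _ => sq_nonneg _
  have hd0 : 0 ≤ d := sq_nonneg _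
  have h1 : ∀ i, ‖g i‖ ^ 2 ≤ 2 * ‖g i - gradient (f i) (z i)‖ ^ 2 +
      4 * ‖gradient (f i) zstar‖ ^ 2 + 32 * l ^ 2 * ‖z i - x‖ ^ 2 + 32 * l ^ 2 * d := by
    intro i
    have h2 := norm_add_sq_le_two (g i - gradient (f i) (z i)) (gradient (f i) (z i))
    have h3 := norm_add_sq_le_two (gradient (f i) (z i) - gradient (f i) zstar)
      (gradient (f i) zstar)
    rw [sub_add_cancel] at h2 h3
    have h4 : ‖gradient (f i) (z i) - gradient (f i) zstar‖ ^ 2 ≤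
        (2 * l * ‖z i - zstar‖) ^ 2 := by
      gcongr
      exact (hf i).norm_gradient_sub_le hμ hl _ _
    have h5 := mul_le_mul_of_nonneg_left (norm_sub_sq_le_two_mul_add (zstar := zstar) (z i) x)
      (by positivity : 0 ≤ 16 * l ^ 2)
    nlinarith
  have h2 : ∀ i, ‖g i‖ ^ 2 / v i ≤ V * ‖g i‖ ^ 2 := by
    intro i
    rw [div_eq_inv_mul]
    gcongr
    exact Finset.single_le_sum (f := fun i => (v i)⁻¹)
      (fun j _ => inv_nonneg.2 (hv j).le) (Finset.mem_univ i)
  have h3 : ∑ i, ‖g i‖ ^ 2 ≤ 2 * N + 4 * S + 32 * l ^ 2 * Z + 32 * l ^ 2 * n * d := by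
    refine (Finset.sum_le_sum fun i _ => h1 i).trans (le_of_eq ?_)
    simp only [Finset.sum_add_distrib, ← Finset.mul_sum]
    simp
    ring
  clear_value N Z d V S
  calc piNormSq v g ≤ ∑ i, V * ‖g i‖ ^ 2 := Finset.sum_le_sum fun i _ => h2 i
    _ = V * ∑ i, ‖g i‖ ^ 2 := by rw [Finset.mul_sum]
    _ ≤ V * (2 * N + 4 * S + 32 * l ^ 2 * Z + 32 * l ^ 2 * n * d) := by gcongr
    _ ≤ V * ((4 * S + 32 * l ^ 2 * n + 32 * l ^ 2 + 2) * (1 + d + Z + N)) := by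
        have hn0 : (0 : ℝ) ≤ n := Nat.cast_nonneg n
        have hl0 : 0 ≤ l ^ 2 := sq_nonneg l
        gcongr
        have q1 : 0 ≤ 4 * S * (d + Z + N) := by positivity
        have q2 : 0 ≤ 32 * l ^ 2 * n * (1 + Z + N) := by positivity
        have q3 : 0 ≤ 32 * l ^ 2 * (1 + d + N) := by positivity
        have q4 : 0 ≤ 2 * (1 + d + Z) := by positivity
        linarith
    _ ≤ _ := by
        have q : 0 ≤ 1 + d + Z + N := by positivity
        linarith

variable {Ω : Type*} [mΩ : MeasurableSpace Ω] {P : Measure Ω} {ℱ : Filtration ℕ mΩ}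
  {z g : ℕ → Fin n → Ω → EuclideanSpace ℝ (Fin p)}

theorem integrable_agreementError (v : Fin n → ℝ) {x : Fin n → Ω → EuclideanSpace ℝ (Fin p)}
    (hx : ∀ i, MemLp (x i) 2 P) : Integrable (fun ω => agreementError v fun i => x i ω) P := by
  refine integrable_piNormSq v fun i => (hx i).sub ?_
  exact memLp_sum_smul _ hx

theorem integrable_optimalityGap [IsFiniteMeasure P] (zstar : EuclideanSpace ℝ (Fin p))
    {x : Fin n → Ω → EuclideanSpace ℝ (Fin p)} (hx : ∀ i, MemLp (x i) 2 P) :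
    Integrable (fun ω => optimalityGap zstar fun i => x i ω) P :=
  integrable_norm_sq ((memLp_mean hx).sub (memLp_const zstar))

theorem integrable_networkError [IsFiniteMeasure P] (zstar : EuclideanSpace ℝ (Fin p))
    {x : Fin n → Ω → EuclideanSpace ℝ (Fin p)} (hx : ∀ i, MemLp (x i) 2 P) :
    Integrable (fun ω => networkError zstar fun i => x i ω) P :=
  (integrable_finsetSum _ fun i _ =>
    integrable_norm_sq ((hx i).sub (memLp_const zstar))).const_mul _

/-- One step of the expected optimality gap. The contraction factor is `1 - lam α_k` with `lam` as
close to `2 μ` as desired. -/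
theorem IsStochasticOracle.exists_integral_optimalityGap_succ_le [IsProbabilityMeasure P]
    (hG : IsStronglyConnectedNetwork G) (hB : IsWeightMatrix G B) (hv : IsPerronVector B v)
    (hμ : 0 < μ) (hl : 0 < l) (hf : ∀ i, IsStronglyConvexSmooth μ l (f i))
    (hmin : ∀ z, globalCost f zstar ≤ globalCost f z) (hθ : 0 < θ) (hm : 0 < m)
    (hg : IsStochasticOracle P ℱ f σ z g)
    (hz : ∀ k i ω, z k i ω = zIter B (decayingStep θ m) x₀ (fun t j => g t j ω) k i)
    {lam : ℝ} (hlam : lam < 2 * μ) :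
    ∃ c, 0 < c ∧ ∀ k,
      ∫ ω, optimalityGap zstar (xIter B (decayingStep θ m) x₀ (fun t j => g t j ω) (k + 1)) ∂P ≤
        (1 - lam * decayingStep θ m k + c * decayingStep θ m k ^ 2) *
          ∫ ω, optimalityGap zstar (xIter B (decayingStep θ m) x₀ (fun t j => g t j ω) k) ∂P
        + decayingStep θ m k ^ 2 * (σ ^ 2 / n)
        + c * decayingStep θ m k *
          (∫ ω, agreementError v (xIter B (decayingStep θ m) x₀ (fun t j => g t j ω) k) ∂P +
            decayingStep θ m k ^ 2 * (∫ ω, optimalityGap zstar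
              (xIter B (decayingStep θ m) x₀ (fun t j => g t j ω) k) ∂P + 1)) := by
  have hn := hv.card_pos
  have h0 := mean_gradient_eq_zero_of_isMin hn hl hf hmin
  obtain ⟨c₁, hc₁, hstep⟩ := norm_sub_smul_mean_gradient_sq_le_of_perturbed hn hμ hl hf h0
    (τ := 2 * μ - lam) (a₀ := θ / m) (by linarith)
  obtain ⟨c₂, hc₂, hcons⟩ := exists_sum_norm_zIter_sub_mean_sq_le hG hB hv hθ hm zstar
  refine ⟨c₁ + c₁ * c₂, by positivity, fun k => ?_⟩
  obtain ⟨hx, -, hzL⟩ := hg.memLp_iterates hμ hl hf hz k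
  obtain ⟨hx', -, -⟩ := hg.memLp_iterates hμ hl hf hz (k + 1)
  have hxm := (hg.stronglyMeasurable_iterates B (decayingStep θ m) x₀ k).1
  have htk : 0 < m + (k : ℝ) := by positivity
  have hα0 : 0 < decayingStep θ m k := div_pos hθ htk
  have hα1 : decayingStep θ m k ≤ θ / m := by
    rw [decayingStep]
    gcongr
    simp
  set α := decayingStep θ m
  set X : Ω → Fin n → EuclideanSpace ℝ (Fin p) := fun ω => xIter B α x₀ (fun t j => g t j ω) k
  set a : Ω → EuclideanSpace ℝ (Fin p) :=
    fun ω => mean (X ω) - zstar - α k • mean (fun i => gradient (f i) (z k i ω)) with ha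
  have hgrad : ∀ i, StronglyMeasurable[ℱ k] fun ω => gradient (f i) (z k i ω) := fun i => by
    simp only [hz]
    exact ((hf i).continuous_gradient hμ hl).comp_stronglyMeasurable ((hxm i).fun_const_smul _)
  have hgradL : ∀ i, MemLp (fun ω => gradient (f i) (z k i ω)) 2 P :=
    fun i => (hf i).memLp_gradient hμ hl (hzL i)
  have hmean : ∀ {x : Fin n → Ω → EuclideanSpace ℝ (Fin p)},
      (∀ i, StronglyMeasurable[ℱ k] (x i)) →
      StronglyMeasurable[ℱ k] fun ω => mean fun i => x i ω := fun {x} h => by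
    have := (stronglyMeasurable_sum_smul (fun _ => 1) h).fun_const_smul (1 / (n : ℝ))
    simpa only [mean, one_smul] using this
  have ham : StronglyMeasurable[ℱ k] a :=
    ((hmean hxm).sub stronglyMeasurable_const).sub ((hmean hgrad).fun_const_smul (α k))
  have haL : MemLp a 2 P :=
    ((memLp_mean hx).sub (memLp_const zstar)).sub (memLp_smul (memLp_mean hgradL) _)
  have h1 : ∀ ω, optimalityGap zstar (xIter B α x₀ (fun t j => g t j ω) (k + 1)) =
      ‖a ω - α k • mean fun i => g k i ω - gradient (f i) (z k i ω)‖ ^ 2 := by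
    intro ω
    rw [optimalityGap, mean_xIter_succ hB, mean_sub, smul_sub]
    simp only [ha]
    congr 2
    abel
  have h2 : ∫ ω, optimalityGap zstar (xIter B α x₀ (fun t j => g t j ω) (k + 1)) ∂P ≤
      ∫ ω, ‖a ω‖ ^ 2 ∂P + α k ^ 2 * (σ ^ 2 / n) := by
    simp only [h1]
    exact hg.integral_norm_sub_smul_mean_noise_sq_le hn
      (fun i => (hg.memLp_sample hμ hl hf hzL i).1) hgrad
      (fun i => (hgradL i).integrable one_le_two) ham haL (α k)
  have h3 : ∫ ω, ‖a ω‖ ^ 2 ∂P ≤ _ := integral_le_of_le_affine (integrable_norm_sq haL)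
    (integrable_optimalityGap zstar hx) (integrable_agreementError v hx) (integrable_const 0)
    (a₁ := 1 - lam * α k + c₁ * α k ^ 2 + c₁ * c₂ * α k ^ 3) (a₂ := c₁ * c₂ * α k) (a₃ := 0)
    (b := c₁ * c₂ * α k ^ 3) (fun ω => by
      have s1 := hstep (α k) (mean (X ω)) (fun i => z k i ω) hα0 hα1
      have s2 := hcons x₀ (fun t j => g t j ω) k
      simp only [← hz] at s2
      have s3 := mul_le_mul_of_nonneg_left s2 (mul_pos hc₁ hα0).le
      rw [sub_sub_cancel] at s1
      have s4 : ‖mean (X ω) - zstar‖ ^ 2 = optimalityGap zstar (X ω) := rfl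
      rw [s4] at s1
      refine (s1.trans (add_le_add_right s3 _)).trans (le_of_eq ?_)
      ring)
  refine h2.trans ((add_le_add_left h3 _).trans ?_)
  have d0 : 0 ≤ ∫ ω, optimalityGap zstar (X ω) ∂P := integral_nonneg fun ω => sq_nonneg _
  have x0 : 0 ≤ ∫ ω, agreementError v (X ω) ∂P :=
    integral_nonneg fun ω => piNormSq_nonneg hv.pos _
  have p1 : 0 ≤ c₁ * c₂ * α k ^ 2 * ∫ ω, optimalityGap zstar (X ω) ∂P := by positivity
  have p2 : 0 ≤ c₁ * α k * (∫ ω, agreementError v (X ω) ∂P +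
      α k ^ 2 * (∫ ω, optimalityGap zstar (X ω) ∂P + 1)) := by positivity
  change (1 - lam * α k + c₁ * α k ^ 2 + c₁ * c₂ * α k ^ 3) * ∫ ω, optimalityGap zstar (X ω) ∂P +
    c₁ * c₂ * α k * ∫ ω, agreementError v (X ω) ∂P + 0 * ∫ ω, 0 ∂P + c₁ * c₂ * α k ^ 3 +
      α k ^ 2 * (σ ^ 2 / n) ≤ _
  linarith

theorem IsStochasticOracle.exists_integral_piNormSq_sample_le [IsProbabilityMeasure P]
    (hG : IsStronglyConnectedNetwork G) (hB : IsWeightMatrix G B) (hv : IsPerronVector B v)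
    (hμ : 0 < μ) (hl : 0 < l) (hf : ∀ i, IsStronglyConvexSmooth μ l (f i))
    (zstar : EuclideanSpace ℝ (Fin p)) (hθ : 0 < θ) (hm : 0 < m)
    (hg : IsStochasticOracle P ℱ f σ z g)
    (hz : ∀ k i ω, z k i ω = zIter B (decayingStep θ m) x₀ (fun t j => g t j ω) k i) :
    ∃ c, 0 < c ∧ ∀ k, ∫ ω, piNormSq v (fun i => g k i ω) ∂P ≤ c *
      (1 + ∫ ω, optimalityGap zstar (xIter B (decayingStep θ m) x₀ (fun t j => g t j ω) k) ∂P +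
        ∫ ω, agreementError v (xIter B (decayingStep θ m) x₀ (fun t j => g t j ω) k) ∂P) := by
  obtain ⟨c₁, hc₁, hsamp⟩ := exists_piNormSq_sample_le hv.pos hμ hl hf zstar
  obtain ⟨c₂, hc₂, hcons⟩ := exists_sum_norm_zIter_sub_mean_sq_le hG hB hv hθ hm zstar
  refine ⟨c₁ * (1 + n * σ ^ 2 + c₂ + c₂ * (θ / m) ^ 2), by positivity, fun k => ?_⟩
  obtain ⟨hx, -, hzL⟩ := hg.memLp_iterates hμ hl hf hz k
  have hgL := fun i => hg.memLp_sample hμ hl hf hzL i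
  have htk : 0 < m + (k : ℝ) := by positivity
  have hα0 : 0 < decayingStep θ m k := div_pos hθ htk
  have hα1 : decayingStep θ m k ≤ θ / m := by
    rw [decayingStep]
    gcongr
    simp
  set α := decayingStep θ m
  set X : Ω → Fin n → EuclideanSpace ℝ (Fin p) := fun ω => xIter B α x₀ (fun t j => g t j ω) k
  have h1 : ∫ ω, piNormSq v (fun i => g k i ω) ∂P ≤ c₁ * (1 + c₂ * (θ / m) ^ 2) *
        ∫ ω, optimalityGap zstar (X ω) ∂P + c₁ * c₂ * ∫ ω, agreementError v (X ω) ∂P +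
        c₁ * ∫ ω, ∑ i, ‖g k i ω - gradient (f i) (z k i ω)‖ ^ 2 ∂P +
        c₁ * (1 + c₂ * (θ / m) ^ 2) :=
    integral_le_of_le_affine (integrable_piNormSq v fun i => (hgL i).2)
    (integrable_optimalityGap zstar hx) (integrable_agreementError v hx)
    (integrable_finsetSum _ fun i _ => integrable_norm_sq (hgL i).1) (fun ω => by
      have s1 := hsamp (mean (X ω)) (fun i => z k i ω) (fun i => g k i ω)
      have s2 := hcons x₀ (fun t j => g t j ω) k
      simp only [← hz] at s2
      have s4 : ‖mean (X ω) - zstar‖ ^ 2 = optimalityGap zstar (X ω) := rfl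
      rw [s4] at s1
      have d0 : 0 ≤ optimalityGap zstar (X ω) := sq_nonneg _
      have s5 : ∑ i, ‖z k i ω - mean (X ω)‖ ^ 2 ≤ c₂ * (agreementError v (X ω) +
          (θ / m) ^ 2 * (optimalityGap zstar (X ω) + 1)) := s2.trans (by gcongr)
      have s6 := mul_le_mul_of_nonneg_left s5 hc₁.le
      refine s1.trans ?_
      change _ ≤ c₁ * (1 + c₂ * (θ / m) ^ 2) * optimalityGap zstar (X ω) +
        c₁ * c₂ * agreementError v (X ω) + _ + _
      linarith)
  have h2 : ∫ ω, ∑ i, ‖g k i ω - gradient (f i) (z k i ω)‖ ^ 2 ∂P ≤ n * σ ^ 2 := by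
    rw [integral_finsetSum _ fun i _ => integrable_norm_sq (hgL i).1]
    refine (Finset.sum_le_sum fun i _ => hg.integral_norm_noise_sq_le k i).trans ?_
    simp
  have d0 : 0 ≤ ∫ ω, optimalityGap zstar (X ω) ∂P := integral_nonneg fun ω => sq_nonneg _
  have x0 : 0 ≤ ∫ ω, agreementError v (X ω) ∂P :=
    integral_nonneg fun ω => piNormSq_nonneg hv.pos _
  have h3 := mul_le_mul_of_nonneg_left h2 hc₁.le
  refine h1.trans ?_
  generalize ∫ ω, optimalityGap zstar (X ω) ∂P = d at *
  generalize ∫ ω, agreementError v (X ω) ∂P = x at *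
  have p1 : 0 ≤ c₁ * (n * σ ^ 2 + c₂) * d := by positivity
  have p2 : 0 ≤ c₁ * (1 + n * σ ^ 2 + c₂ * (θ / m) ^ 2) * x := by positivity
  have p3 : 0 ≤ c₁ * c₂ := by positivity
  linarith

/-- Convergence rates of the agreement error and of the optimality gap. Choosing
`lam = μ + 1 / θ < 2 μ` makes the contraction exponent `lam θ = θ μ + 1` exceed `2`, so that no
term of order `(m + k) ^ (-θ μ)` is needed. -/
theorem IsStochasticOracle.rates [IsProbabilityMeasure P]
    (hG : IsStronglyConnectedNetwork G) (hB : IsWeightMatrix G B) (hv : IsPerronVector B v)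
    (hμ : 0 < μ) (hl : 0 < l) (hf : ∀ i, IsStronglyConvexSmooth μ l (f i))
    (hmin : ∀ z, globalCost f zstar ≤ globalCost f z) (hθ : 1 / μ < θ) (hm : 0 < m)
    (hg : IsStochasticOracle P ℱ f σ z g)
    (hz : ∀ k i ω, z k i ω = zIter B (decayingStep θ m) x₀ (fun t j => g t j ω) k i) :
    (∃ C, ∀ k : ℕ,
      ∫ ω, agreementError v (xIter B (decayingStep θ m) x₀ (fun t j => g t j ω) k) ∂P ≤
        C / (m + k) ^ 2) ∧
    ∃ C, ∀ k : ℕ,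
      ∫ ω, optimalityGap zstar (xIter B (decayingStep θ m) x₀ (fun t j => g t j ω) k) ∂P ≤
        θ ^ 2 * σ ^ 2 / (n * (θ * μ - 1) * (m + k)) + C / (m + k) ^ 2 := by
  have hn' : (0 : ℝ) < n := by exact_mod_cast hv.card_pos
  have hθ0 : 0 < θ := (one_div_pos.2 hμ).trans hθ
  have hθμ : 1 < θ * μ := (div_lt_iff₀ hμ).1 hθ
  have hlam : μ + 1 / θ < 2 * μ := by
    have : 1 / θ < μ := by
      rw [div_lt_iff₀ hθ0]
      linarith
    linarith
  have hlam' : (μ + 1 / θ) * θ = θ * μ + 1 := by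
    field_simp
  obtain ⟨r, c₁, hr0, hr1, hc₁, hcontr⟩ := exists_contraction (p := p) hG hB hv
  obtain ⟨c₂, hc₂, hH⟩ := hg.exists_integral_piNormSq_sample_le hG hB hv hμ hl hf zstar hθ0 hm hz
  obtain ⟨c₃, hc₃, hD⟩ := hg.exists_integral_optimalityGap_succ_le hG hB hv hμ hl hf hmin hθ0 hm
    hz hlam
  have hL := hg.memLp_iterates hμ hl hf hz
  have iA := fun k => integrable_agreementError v (hL k).1
  have iU := fun k => integrable_piNormSq v (hL k).2.1
  have iH := fun k => integrable_piNormSq v fun i => (hg.memLp_sample hμ hl hf (hL k).2.2 i).2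
  have α0 : ∀ k : ℕ, 0 ≤ decayingStep θ m k := fun k => by
    rw [decayingStep]
    positivity
  have d0 : ∀ k, 0 ≤ ∫ ω, optimalityGap zstar
      (xIter B (decayingStep θ m) x₀ (fun t j => g t j ω) k) ∂P :=
    fun k => integral_nonneg fun ω => sq_nonneg _
  have x0 : ∀ k, 0 ≤ ∫ ω, agreementError v
      (xIter B (decayingStep θ m) x₀ (fun t j => g t j ω) k) ∂P :=
    fun k => integral_nonneg fun ω => piNormSq_nonneg hv.pos _
  have u0 : ∀ k, 0 ≤ ∫ ω, piNormSq v (trackDev B (fun t j => g t j ω) k) ∂P :=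
    fun k => integral_nonneg fun ω => piNormSq_nonneg hv.pos _
  have h0 : ∀ k, 0 ≤ ∫ ω, piNormSq v (fun i => g k i ω) ∂P :=
    fun k => integral_nonneg fun ω => piNormSq_nonneg hv.pos _
  have hX : ∀ k, ∫ ω, agreementError v
        (xIter B (decayingStep θ m) x₀ (fun t j => g t j ω) (k + 1)) ∂P ≤
      r * ∫ ω, agreementError v (xIter B (decayingStep θ m) x₀ (fun t j => g t j ω) k) ∂P +
      c₁ * decayingStep θ m k ^ 2 * ∫ ω, piNormSq v (trackDev B (fun t j => g t j ω) k) ∂P +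
      c₁ * decayingStep θ m k ^ 2 * ∫ ω, piNormSq v (fun i => g k i ω) ∂P + 0 :=
    fun k => integral_le_of_le_affine (iA (k + 1)) (iA k) (iU k) (iH k) fun ω => by
      have := (hcontr (decayingStep θ m) x₀ (fun t j => g t j ω) k).1
      refine this.trans (le_of_eq ?_)
      rw [mul_add, add_zero, ← add_assoc]
  have hU : ∀ k, ∫ ω, piNormSq v (trackDev B (fun t j => g t j ω) (k + 1)) ∂P ≤
      r * ∫ ω, piNormSq v (trackDev B (fun t j => g t j ω) k) ∂P +
      c₁ * ∫ ω, piNormSq v (fun i => g k i ω) ∂P +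
      0 * ∫ ω, piNormSq v (fun i => g k i ω) ∂P + 0 :=
    fun k => integral_le_of_le_affine (iU (k + 1)) (iU k) (iH k) (iH k) fun ω => by
      have := (hcontr (decayingStep θ m) x₀ (fun t j => g t j ω) k).2
      refine this.trans (le_of_eq ?_)
      rw [zero_mul, add_zero, add_zero]
  obtain ⟨hA, C, hC⟩ := rates_of_coupled_recursion (c := c₁ + c₂ + c₃) (lam := μ + 1 / θ)
    (s := σ ^ 2 / n) hm hθ0 hr0 hr1 (by positivity) (by linarith) (by positivity) d0 x0 u0
    (fun k => (hX k).trans (by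
      rw [add_zero, add_assoc, ← mul_add]
      have := add_nonneg (u0 k) (h0 k)
      gcongr
      linarith))
    (fun k => (hU k).trans (by
      rw [zero_mul, add_zero, add_zero]
      have := h0 k
      gcongr
      linarith))
    (fun k => (hH k).trans (by
      have := d0 k
      have := x0 k
      gcongr
      linarith))
    (fun k => (hD k).trans (by
      have := d0 k
      have := x0 k
      have := α0 k
      gcongr
      all_goals linarith))
  refine ⟨hA, C, fun k => (hC k).trans ?_⟩
  have htk : 0 < m + (k : ℝ) := by positivity
  have hp : 0 < θ * μ - 1 := by linarith
  rw [hlam']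
  refine add_le_add ?_ le_rfl
  calc θ ^ 2 * (σ ^ 2 / n) / (θ * μ + 1 - 1) / (m + k)
      = θ ^ 2 * σ ^ 2 / (n * (θ * μ + 1 - 1) * (m + k)) := by
        field_simp
    _ ≤ _ := by
        gcongr
        linarith

/-- The rate of the mean squared error over the network: twice the optimality gap, and a
remainder of higher order from the disagreement and the eigenvector estimates. -/
theorem IsStochasticOracle.networkError_rate [IsProbabilityMeasure P]
    (hG : IsStronglyConnectedNetwork G) (hB : IsWeightMatrix G B) (hv : IsPerronVector B v)
    (hμ : 0 < μ) (hl : 0 < l) (hf : ∀ i, IsStronglyConvexSmooth μ l (f i))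
    (hmin : ∀ z, globalCost f zstar ≤ globalCost f z) (hθ : 1 / μ < θ) (hm : 0 < m)
    (hg : IsStochasticOracle P ℱ f σ z g)
    (hz : ∀ k i ω, z k i ω = zIter B (decayingStep θ m) x₀ (fun t j => g t j ω) k i) :
    ∃ C, ∀ k : ℕ, ∫ ω, networkError zstar (fun i => z k i ω) ∂P ≤
      2 * θ ^ 2 * σ ^ 2 / (n * (θ * μ - 1) * (m + k)) + C / (m + k) ^ 2 := by
  have hn' : (0 : ℝ) < n := by exact_mod_cast hv.card_pos
  have hθ0 : 0 < θ := (one_div_pos.2 hμ).trans hθ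
  have hθμ : 1 < θ * μ := (div_lt_iff₀ hμ).1 hθ
  obtain ⟨⟨CA, hA⟩, C, hC⟩ := hg.rates hG hB hv hμ hl hf hmin hθ hm hz
  obtain ⟨c₂, hc₂, hcons⟩ := exists_sum_norm_zIter_sub_mean_sq_le hG hB hv hθ0 hm zstar
  have hL := hg.memLp_iterates hμ hl hf hz
  set Q := θ ^ 2 * σ ^ 2 / (n * (θ * μ - 1) * m) + |C| / m ^ 2 with hQ
  have hp : 0 < θ * μ - 1 := by linarith
  refine ⟨2 * C + 2 / n * c₂ * (CA + θ ^ 2 * (Q + 1)), fun k => ?_⟩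
  obtain ⟨hx, -, hzL⟩ := hL k
  have htk : 0 < m + (k : ℝ) := by positivity
  have hmk : m ≤ m + (k : ℝ) := by simp
  have h1 : ∫ ω, networkError zstar (fun i => z k i ω) ∂P ≤
      (2 + 2 / n * c₂ * decayingStep θ m k ^ 2) *
        ∫ ω, optimalityGap zstar (xIter B (decayingStep θ m) x₀ (fun t j => g t j ω) k) ∂P +
      2 / n * c₂ *
        ∫ ω, agreementError v (xIter B (decayingStep θ m) x₀ (fun t j => g t j ω) k) ∂P +
      0 * ∫ _ω, (0 : ℝ) ∂P + 2 / n * c₂ * decayingStep θ m k ^ 2 :=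
    integral_le_of_le_affine (integrable_networkError zstar hzL)
    (integrable_optimalityGap zstar hx) (integrable_agreementError v hx) (integrable_const 0)
    fun ω => by
      have s2 := hcons x₀ (fun t j => g t j ω) k
      simp only [← hz] at s2
      set x := xIter B (decayingStep θ m) x₀ (fun t j => g t j ω) k
      have s3 : ∑ i, ‖z k i ω - zstar‖ ^ 2 ≤
          2 * ∑ i, ‖z k i ω - mean x‖ ^ 2 + n * (2 * optimalityGap zstar x) := by
        refine (Finset.sum_le_sum fun i _ =>
          norm_sub_sq_le_two_mul_add (z k i ω) (mean x)).trans (le_of_eq ?_)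
        rw [Finset.sum_add_distrib, ← Finset.mul_sum]
        simp [optimalityGap]
      have s4 : ∑ i, ‖z k i ω - zstar‖ ^ 2 ≤ 2 * (c₂ * (agreementError v x +
          decayingStep θ m k ^ 2 * (optimalityGap zstar x + 1))) +
          n * (2 * optimalityGap zstar x) := s3.trans (by gcongr)
      calc networkError zstar (fun i => z k i ω)
          ≤ 1 / n * (2 * (c₂ * (agreementError v x +
            decayingStep θ m k ^ 2 * (optimalityGap zstar x + 1))) +
            n * (2 * optimalityGap zstar x)) := by
            rw [networkError]
            gcongr
        _ = (2 + 2 / n * c₂ * decayingStep θ m k ^ 2) * optimalityGap zstar x +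
            2 / n * c₂ * agreementError v x + 0 * 0 + 2 / n * c₂ * decayingStep θ m k ^ 2 := by
            field_simp
            ring
  refine h1.trans ?_
  have hCk := hC k
  have hAk := hA k
  have hQk : ∫ ω, optimalityGap zstar
      (xIter B (decayingStep θ m) x₀ (fun t j => g t j ω) k) ∂P ≤ Q := by
    refine hCk.trans ?_
    rw [hQ]
    gcongr
    exact le_abs_self C
  generalize ∫ ω, optimalityGap zstar
    (xIter B (decayingStep θ m) x₀ (fun t j => g t j ω) k) ∂P = d at *
  generalize ∫ ω, agreementError v
    (xIter B (decayingStep θ m) x₀ (fun t j => g t j ω) k) ∂P = x at *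
  calc _ = 2 * d + 2 / n * c₂ * (x + decayingStep θ m k ^ 2 * (d + 1)) := by ring
    _ ≤ 2 * (θ ^ 2 * σ ^ 2 / (n * (θ * μ - 1) * (m + k)) + C / (m + k) ^ 2) +
        2 / n * c₂ * (CA / (m + k) ^ 2 + decayingStep θ m k ^ 2 * (Q + 1)) := by gcongr
    _ = _ := by
        rw [decayingStep, div_pow]
        ring

end Rates

end SADDOPT

theorem theorem2
    {n p : ℕ}
    (G : Digraph (Fin n)) (hG : IsStronglyConnectedNetwork G)
    (B : Matrix (Fin n) (Fin n) ℝ) (hB : IsWeightMatrix G B)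
    (v : Fin n → ℝ) (hv : IsPerronVector B v)
    (μ l : ℝ) (hμ : 0 < μ) (hl : 0 < l)
    (f : Fin n → EuclideanSpace ℝ (Fin p) → ℝ)
    (hf : ∀ i, IsStronglyConvexSmooth μ l (f i))
    (zstar : EuclideanSpace ℝ (Fin p)) (hz : ∀ z, globalCost f zstar ≤ globalCost f z)
    (θ m : ℝ) (hθ : 1 / μ < θ)
    (hm : max (θ * (l + μ) / 2)
        (6 * l * θ * yInvSup B * √((1 + sigmaB B v ^ 2) * hRatio v) / (1 - sigmaB B v ^ 2)) < m)
    (hm' : E2Const B v l θ m / m ^ 2 +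
          (θ ^ 3 * l ^ 6 * E1Const B v * E3Const B v / (m ^ 4 * n * (θ * μ - 1))) *
            ((θ * μ + m) / (m * μ)) <
        (1 - sigmaB B v ^ 2) ^ 2 / (6 * θ ^ 2 * (1 + sigmaB B v ^ 2)) *
          ((1 - sigmaB B v ^ 2) / 2 - (2 * m + 1) / (m + 1) ^ 2))
    {Ω : Type*} [mΩ : MeasurableSpace Ω] (P : Measure Ω) [IsProbabilityMeasure P]
    (ℱ : Filtration ℕ mΩ) (σ : ℝ)
    (x₀ : Fin n → EuclideanSpace ℝ (Fin p))
    (g x z : ℕ → Fin n → Ω → EuclideanSpace ℝ (Fin p))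
    (hx : ∀ k i ω, x k i ω = xIter B (decayingStep θ m) x₀ (fun t j => g t j ω) k i)
    (hzk : ∀ k i ω, z k i ω = zIter B (decayingStep θ m) x₀ (fun t j => g t j ω) k i)
    (hg : IsStochasticOracle P ℱ f σ z g) :
    -- the expectations below are finite, and `σ_B ^ k ≤ 1 / (n (m + k)²)` for all large `k`
    (∀ k, Integrable (fun ω => agreementError v (fun i => x k i ω)) P ∧
      Integrable (fun ω => optimalityGap zstar (fun i => x k i ω)) P ∧
      Integrable (fun ω => networkError zstar (fun i => z k i ω)) P) ∧
    (∃ S : ℕ, ∀ k : ℕ, S ≤ k → sigmaB B v ^ k ≤ 1 / (n * (m + k) ^ 2)) ∧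
    -- agreement error
    (∃ C : ℝ, ∀ k : ℕ,
      ∫ ω, agreementError v (fun i => x k i ω) ∂P ≤ C / (m + k) ^ 2) ∧
    -- optimality gap
    (∃ C C' : ℝ, ∀ k : ℕ,
      ∫ ω, optimalityGap zstar (fun i => x k i ω) ∂P ≤
        2 * θ ^ 2 * σ ^ 2 / (n * (θ * μ - 1) * (m + k)) +
          C / (m + k) ^ (θ * μ) + C' / (m + k) ^ 2) ∧
    -- the network error vanishes at the rate `O(1/k)`, and its leading term does not depend
    -- on the network
    Tendsto (fun k : ℕ => ∫ ω, networkError zstar (fun i => z k i ω) ∂P) atTop (𝓝 0) ∧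
    ((fun k : ℕ => ∫ ω, networkError zstar (fun i => z k i ω) ∂P)
      =O[atTop] fun k : ℕ => 1 / (k : ℝ)) ∧
    (∃ C C' : ℝ, ∀ k : ℕ,
      ∫ ω, networkError zstar (fun i => z k i ω) ∂P ≤
        4 * θ ^ 2 * σ ^ 2 / (n * (θ * μ - 1) * (m + k)) +
          C / (m + k) ^ (θ * μ) + C' / (m + k) ^ 2) := by
  -- among the lower bounds on `m`, the first one makes all denominators `m + k` positive
  have hm0 : 0 < m := by
    have hθ0 : 0 < θ := (one_div_pos.2 hμ).trans hθ
    refine lt_of_le_of_lt ?_ ((le_max_left _ _).trans_lt hm)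
    positivity
  have hθμ : 1 < θ * μ := (div_lt_iff₀ hμ).1 hθ
  have hL := hg.memLp_iterates hμ hl hf hzk
  have hx' : x = fun k i ω => xIter B (decayingStep θ m) x₀ (fun t j => g t j ω) k i :=
    funext fun k => funext fun i => funext fun ω => hx k i ω
  subst hx'
  obtain ⟨hA, C, hC⟩ := hg.rates hG hB hv hμ hl hf hz hθ hm0 hzk
  obtain ⟨C', hC'⟩ := hg.networkError_rate hG hB hv hμ hl hf hz hθ hm0 hzk
  have hn : (0 : ℝ) < n := by exact_mod_cast hv.card_pos
  have hp : 0 < θ * μ - 1 := by linarith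
  have hO : ∀ k : ℕ, 1 ≤ k → ∫ ω, networkError zstar (fun i => z k i ω) ∂P ≤
      (2 * θ ^ 2 * σ ^ 2 / (n * (θ * μ - 1)) + |C'|) * (1 / (k : ℝ)) := by
    intro k hk
    have hk' : (1 : ℝ) ≤ k := by exact_mod_cast hk
    have h1 : 2 * θ ^ 2 * σ ^ 2 / (n * (θ * μ - 1) * (m + k)) ≤
        2 * θ ^ 2 * σ ^ 2 / (n * (θ * μ - 1) * k) := by
      gcongr
      linarith
    have h2 : C' / (m + k) ^ 2 ≤ |C'| / k := by
      gcongr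
      · exact le_abs_self C'
      · nlinarith
    refine (hC' k).trans ((add_le_add h1 h2).trans (le_of_eq ?_))
    field_simp
  have hnonneg : ∀ k : ℕ, 0 ≤ ∫ ω, networkError zstar (fun i => z k i ω) ∂P := fun k =>
    integral_nonneg fun ω =>
      mul_nonneg (by positivity) (Finset.sum_nonneg fun i _ => sq_nonneg _)
  have hBigO : (fun k : ℕ => ∫ ω, networkError zstar (fun i => z k i ω) ∂P)
      =O[atTop] fun k : ℕ => 1 / (k : ℝ) := by
    refine Asymptotics.IsBigO.of_bound
      (2 * θ ^ 2 * σ ^ 2 / (n * (θ * μ - 1)) + |C'|) (eventually_atTop.2 ⟨1, fun k hk => ?_⟩)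
    rw [Real.norm_of_nonneg (hnonneg k), Real.norm_of_nonneg (by positivity)]
    exact hO k hk
  refine ⟨fun k => ⟨integrable_agreementError v (hL k).1, integrable_optimalityGap zstar (hL k).1,
    integrable_networkError zstar (hL k).2.2⟩, exists_sigmaB_pow_le hG hB hv hm0, hA,
    ⟨0, C, fun k => ?_⟩, hBigO.trans_tendsto tendsto_one_div_atTop_nhds_zero_nat, hBigO,
    0, C', fun k => ?_⟩
  -- the rates proved are the stronger ones without the term of order `(m + k) ^ (-θ μ)`
  · rw [zero_div, add_zero]
    refine (hC k).trans ?_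
    have htk : 0 < m + (k : ℝ) := by positivity
    gcongr
    exact le_mul_of_one_le_left (sq_nonneg θ) one_le_two
  · rw [zero_div, add_zero]
    refine (hC' k).trans ?_
    have htk : 0 < m + (k : ℝ) := by positivity
    gcongr
    norm_num
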